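/- Let $(W,S)$ be a Coxeter system of finite rank $n$, $S=\{s_1,\dots,s_n\}$, with orders $m_{ij}$ of $s_is_j$. Let $V=\mathbb R^n$ with standard orthonormal basis $\Delta=\{\alpha_1,\dots,\alpha_n\}$, and let $B$ be a symmetric bilinear form on $V$ with $B(\alpha_i,\alpha_j)=-\cos(\pi/m_{ij})$ if $m_{ij}<\infty$ (so $B(\alpha_i,\alpha_i)=1$) and $B(\alpha_i,\alpha_j)\le -1$ an arbitrary real number if $m_{ij}=\infty$. The group $W$ acts linearly on $V$, with $s_i$ acting as $v\mapsto v-2B(\alpha_i,v)\alpha_i$. Assume that $W$ is irreducible (that is, $\Delta$ is not a disjoint union of two non-empty $B$-orthogonal subsets) and that $B$ has signature $(n-1,1)$. Let $o=\sum_i o_i\alpha_i$ be an eigenvector of Euclidean norm $1$ of the matrix $(B(\alpha_i,\alpha_j))_{i,j}$ for its negative eigenvalue (it is unique up to sign, and either sign may be chosen). Put $|v|_1=\sum_i o_iv_i$ for $v=\sum_i v_i\alpha_i$, $V_1=\{v:|v|_1=1\}$, $\widehat v=v/|v|_1$ if $|v|_1\neq 0$, and $\widehat Q=\{x\in V_1: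 B(x,x)=0\}$. For $w\in W$ and $x\in\widehat Q$ let $w\cdot x=\widehat{w(x)}$ (the normalized action). Let $\Phi=W(\Delta)$ be the set of roots and let $E$ be the set of all limits of injective sequences of normalized roots, i.e. of elements of $\{\widehat\rho:\rho\in\Phi\}$. For a subset $\Delta_I\subseteq\Delta$ (possibly empty or all of $\Delta$) let $W_I=\langle s_i:\alpha_i\in\Delta_I\rangle$, and let $E_I$ be the set of all limits of injective sequences in $\{\widehat\rho:\rho\in W_I(\Delta_I)\}$. Call $\Delta_I$ generating if $\widehat Q\cap\operatorname{span}(\Delta_I)\subseteq\operatorname{conv}(\{\widehat\alpha:\alpha\in\Delta\})\cap\operatorname{span}(\Delta_I)$. Then: (i) for every generating $\Delta_I\subseteq\Delta$, $E_I=\widehat Q\cap\operatorname{span}(\Delta_I)$; (ii) the set $$F_0=W\cdot\Bigl(\bigcup_{\Delta_I\subseteq\Delta\text{ generating}}\widehat Q\cap\operatorname{span}(\Delta_I)\Bigr)$$ is a subset of $\widehat Q$ with $w\cdot F_0=F_0$ for all $w\in W$, and $E$ is the topological closure of $F_0$. -/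

import Mathlib

open Filter Topology

noncomputable section

/-- A matrix `B` defining a geometric representation of the Coxeter group with Coxeter matrix `M`:
it is symmetric, `B i j = -cos (π / m i j)` if `m i j` is finite (so `B i i = 1`, as `m i i = 1`),
and `B i j` is any real number `≤ -1` if `m i j = ∞` (which `CoxeterMatrix` encodes as `0`). -/
structure CoxeterForm {ι : Type*} (M : CoxeterMatrix ι) where
  mat : Matrix ι ι ℝ
  isSymm : mat.IsSymm
  apply_of_ne_zero : ∀ i j, M i j ≠ 0 → mat i j = -Real.cos (Real.pi / M i j)
  apply_of_eq_zero : ∀ i j, M i j = 0 → mat i j ≤ -1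

/-- The simple root `α i`; the simple roots are the standard orthonormal basis of `ℝ^ι`. -/
def simpleRoot {ι : Type*} [DecidableEq ι] (i : ι) : EuclideanSpace ℝ ι :=
  EuclideanSpace.single i 1

/-- `Δ_I`, the set of the simple roots indexed by `I`. -/
def simpleRoots {ι : Type*} [DecidableEq ι] (I : Set ι) : Set (EuclideanSpace ℝ ι) :=
  simpleRoot '' I

/-- `|v|₁ = ∑ i, o i * v i`, the Euclidean inner product of `o` and `v`. -/
def height {ι : Type*} [Fintype ι] (o v : EuclideanSpace ℝ ι) : ℝ :=
  ∑ i, o i * v i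

/-- The normalized vector `v / |v|₁` (meaningful when `|v|₁ ≠ 0`). -/
def normalized {ι : Type*} [Fintype ι] (o v : EuclideanSpace ℝ ι) : EuclideanSpace ℝ ι :=
  (height o v)⁻¹ • v

/-- The set of all limits of injective sequences in `A`. -/
def accumulationPoints {X : Type*} [TopologicalSpace X] (A : Set X) : Set X :=
  {x | ∃ u : ℕ → X, Function.Injective u ∧ (∀ k, u k ∈ A) ∧ Tendsto u atTop (𝓝 x)}

namespace CoxeterForm

theorem mat_self {ι : Type*} {M : CoxeterMatrix ι} (B : CoxeterForm M) (i : ι) : B.mat i i = 1 := by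
  rw [B.apply_of_ne_zero i i (by simp)]; simp

variable {ι : Type*} [Fintype ι] [DecidableEq ι] {M : CoxeterMatrix ι}

/-- `Δ` is not a disjoint union of two non-empty subsets that are orthogonal for `B`. -/
def IsIrreducible (B : CoxeterForm M) : Prop :=
  ∀ J : Set ι, J.Nonempty → Jᶜ.Nonempty → ∃ i ∈ J, ∃ j ∈ Jᶜ, B.mat i j ≠ 0

/-- The bilinear form on `V` with `B (α i) (α j) = B.mat i j`. -/
def form (B : CoxeterForm M) : LinearMap.BilinForm ℝ (EuclideanSpace ℝ ι) :=
  Matrix.toBilin (EuclideanSpace.basisFun ι ℝ).toBasis B.mat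

/-- The bilinear form has signature `(p, q)`. -/
def HasSignature (B : CoxeterForm M) (p q : ℕ) : Prop :=
  sigPos B.form.toQuadraticMap = p ∧ sigNeg B.form.toQuadraticMap = q

theorem form_simpleRoot (B : CoxeterForm M) (i j : ι) :
    B.form (simpleRoot i) (simpleRoot j) = B.mat i j := by
  have h := LinearMap.BilinForm.toMatrix_apply (EuclideanSpace.basisFun ι ℝ).toBasis B.form i j
  simp only [form, LinearMap.BilinForm.toMatrix_toBilin, OrthonormalBasis.coe_toBasis,
    EuclideanSpace.basisFun_apply] at h
  exact h.symm

theorem two_form_simpleRoot (B : CoxeterForm M) (i : ι) :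
    ((2 : ℝ) • B.form (simpleRoot i)) (simpleRoot i) = 2 := by
  simp [form_simpleRoot, mat_self]

/-- The `B`-reflection `v ↦ v - 2 B(α i, v) α i` in the simple root `α i`. -/
def simpleReflection (B : CoxeterForm M) (i : ι) :
    EuclideanSpace ℝ ι ≃ₗ[ℝ] EuclideanSpace ℝ ι :=
  Module.reflection (B.two_form_simpleRoot i)

theorem simpleReflection_apply (B : CoxeterForm M) (i : ι) (v : EuclideanSpace ℝ ι) :
    B.simpleReflection i v = v - (2 * B.form (simpleRoot i) v) • simpleRoot i := by
  simp [simpleReflection, Module.reflection_apply]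

/-- The simple `B`-reflections satisfy the Coxeter relations. -/
theorem isLiftable (B : CoxeterForm M) : M.IsLiftable B.simpleReflection := by
  intro i j
  by_cases h0 : M i j = 0
  · rw [h0, pow_zero]
  by_cases h1 : i = j
  · subst h1
    rw [M.diagonal, pow_one]
    ext1 v
    exact Module.involutive_reflection (B.two_form_simpleRoot i) v
  have hne := M.off_diagonal i j h1
  have hsym : B.mat j i = B.mat i j := B.isSymm.apply i j
  have hB := B.apply_of_ne_zero i j h0
  by_cases h2 : M i j = 2
  · have hz : B.mat i j = 0 := by rw [hB, h2]; simp
    rw [h2, pow_two]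
    ext1 v
    simp only [LinearEquiv.mul_apply, simpleReflection_apply, map_sub, map_smul, form_simpleRoot,
      hsym, hz, mat_self, LinearEquiv.coe_one, id_eq]
    module
  have h3 : 3 ≤ M i j := by lia
  generalize M i j = m at *
  have hm : (0 : ℝ) < m := by exact_mod_cast (by lia : 0 < m)
  have h3' : (3 : ℝ) ≤ m := by exact_mod_cast h3
  set φ : ℝ := 2 * (Real.pi / m) with hφ
  have hmφ : m * φ = 2 * Real.pi := by rw [hφ]; field_simp
  have hsin : Real.sin φ ≠ 0 := by
    apply ne_of_gt
    apply Real.sin_pos_of_pos_of_lt_pi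
    · rw [hφ]; positivity
    · have := Real.pi_pos
      nlinarith
  have ht : 2 * Real.cos φ = ((2 : ℝ) • B.form (simpleRoot i)) (simpleRoot j) *
      ((2 : ℝ) • B.form (simpleRoot j)) (simpleRoot i) - 2 := by
    simp only [LinearMap.smul_apply, form_simpleRoot, hsym, hB, smul_eq_mul, hφ, Real.cos_two_mul]
    ring
  have hS (k : ℤ) := Polynomial.Chebyshev.S_two_mul_real_cos φ k
  ext1 v
  rw [simpleReflection, simpleReflection,
    Module.reflection_mul_reflection_pow_apply _ _ m v (2 * Real.cos φ) ht]
  rcases Nat.even_or_odd' m with ⟨k, hk | hk⟩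
  · have e1 : ((m : ℤ) - 2) / 2 = k - 1 := by lia
    have e2 : ((m : ℤ) - 1) / 2 = k - 1 := by lia
    have hkφ : (k : ℝ) * φ = Real.pi := by
      have : (m : ℝ) = 2 * k := by exact_mod_cast hk
      rw [this] at hmφ; linarith
    have hz : (Polynomial.Chebyshev.S ℝ (k - 1)).eval (2 * Real.cos φ) = 0 := by
      have := hS (k - 1)
      push_cast at this
      rw [sub_add_cancel, hkφ, Real.sin_pi] at this
      exact (mul_eq_zero.1 this).resolve_right hsin
    rw [e1, e2, hz]
    simp
  · have e1 : ((m : ℤ) - 2) / 2 = k - 1 := by lia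
    have e2 : ((m : ℤ) - 1) / 2 = k := by lia
    have e3 : ((m : ℤ) - 3) / 2 = k - 1 := by lia
    have e4 : (m : ℤ) / 2 = k := by lia
    have hz : (Polynomial.Chebyshev.S ℝ k).eval (2 * Real.cos φ) +
        (Polynomial.Chebyshev.S ℝ (k - 1)).eval (2 * Real.cos φ) = 0 := by
      have ha := hS k
      have hb := hS (k - 1)
      push_cast at ha hb
      rw [sub_add_cancel] at hb
      have hkφ : ((k : ℝ) + 1) * φ = 2 * Real.pi - k * φ := by
        have : (m : ℝ) = 2 * k + 1 := by exact_mod_cast hk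
        rw [this] at hmφ; linarith
      rw [hkφ, Real.sin_two_pi_sub] at ha
      refine (mul_eq_zero.1 ?_).resolve_right hsin
      linear_combination ha + hb
    rw [e1, e2, e3, e4, hz]
    simp

/-- The action of the Coxeter group `W` on `V`, in which the generator `s i` acts as the
`B`-reflection in `α i`. -/
def rep (B : CoxeterForm M) {W : Type*} [Group W] (cs : CoxeterSystem M W) :
    W →* (EuclideanSpace ℝ ι ≃ₗ[ℝ] EuclideanSpace ℝ ι) :=
  cs.lift ⟨B.simpleReflection, B.isLiftable⟩

theorem rep_simple (B : CoxeterForm M) {W : Type*} [Group W] (cs : CoxeterSystem M W) (i : ι) :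
    B.rep cs (cs.simple i) = B.simpleReflection i :=
  cs.lift_apply_simple B.isLiftable i

/-- `o` is an eigenvector of the matrix `B`, of Euclidean norm `1`, for a negative eigenvalue.
In signature `(n - 1, 1)` it is unique up to sign. -/
def IsNegativeUnitEigenvector (B : CoxeterForm M) (o : EuclideanSpace ℝ ι) : Prop :=
  ‖o‖ = 1 ∧ ∃ c : ℝ, c < 0 ∧ ∀ i, ∑ j, B.mat i j * o j = c * o i

/-- The projected isotropic cone `{x ∈ V₁ | B(x, x) = 0}`. -/
def isotropic (B : CoxeterForm M) (o : EuclideanSpace ℝ ι) : Set (EuclideanSpace ℝ ι) :=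
  {x | height o x = 1 ∧ B.form x x = 0}

variable {W : Type*} [Group W]

/-- The root system `Φ = W(Δ)`. -/
def roots (B : CoxeterForm M) (cs : CoxeterSystem M W) : Set (EuclideanSpace ℝ ι) :=
  {v | ∃ w : W, ∃ i, v = B.rep cs w (simpleRoot i)}

/-- The root system `Φ_I = W_I(Δ_I)` of the parabolic subgroup `W_I = ⟨s i : i ∈ I⟩`. -/
def parabolicRoots (B : CoxeterForm M) (cs : CoxeterSystem M W) (I : Set ι) :
    Set (EuclideanSpace ℝ ι) :=
  {v | ∃ w ∈ Subgroup.closure (cs.simple '' I), ∃ i ∈ I, v = B.rep cs w (simpleRoot i)}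

/-- `E`, the set of accumulation points of the normalized roots. -/
def limitRoots (B : CoxeterForm M) (cs : CoxeterSystem M W) (o : EuclideanSpace ℝ ι) :
    Set (EuclideanSpace ℝ ι) :=
  accumulationPoints (normalized o '' B.roots cs)

/-- `E_I`, the set of accumulation points of the normalized roots of `W_I`. -/
def parabolicLimitRoots (B : CoxeterForm M) (cs : CoxeterSystem M W) (o : EuclideanSpace ℝ ι)
    (I : Set ι) : Set (EuclideanSpace ℝ ι) :=
  accumulationPoints (normalized o '' B.parabolicRoots cs I)

/-- The part of the projected isotropic cone in the span of `Δ_I`. -/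
def isotropicSpan (B : CoxeterForm M) (o : EuclideanSpace ℝ ι) (I : Set ι) :
    Set (EuclideanSpace ℝ ι) :=
  B.isotropic o ∩ (Submodule.span ℝ (simpleRoots I) : Set (EuclideanSpace ℝ ι))

/-- `Δ_I` is generating: the part of the projected isotropic cone in the span of `Δ_I` lies in the
convex hull of the normalized simple roots (and in the span of `Δ_I`). -/
def IsGenerating (B : CoxeterForm M) (o : EuclideanSpace ℝ ι) (I : Set ι) : Prop :=
  B.isotropicSpan o I ⊆
    convexHull ℝ (normalized o '' simpleRoots (Set.univ : Set ι)) ∩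
      (Submodule.span ℝ (simpleRoots I) : Set (EuclideanSpace ℝ ι))

/-- The normalized action `w · v = w(v) / |w(v)|₁`. -/
def normalizedAction (B : CoxeterForm M) (cs : CoxeterSystem M W) (o : EuclideanSpace ℝ ι)
    (w : W) (v : EuclideanSpace ℝ ι) : EuclideanSpace ℝ ι :=
  normalized o (B.rep cs w v)

/-- The set `F₀`: the union of the orbits, under the normalized action, of the points of the
projected isotropic cone lying in the span of some generating `Δ_I`. -/
def selfSimilarSet (B : CoxeterForm M) (cs : CoxeterSystem M W) (o : EuclideanSpace ℝ ι) :
    Set (EuclideanSpace ℝ ι) :=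
  {y | ∃ w : W, ∃ I : Set ι, B.IsGenerating o I ∧
    ∃ x ∈ B.isotropicSpan o I, y = B.normalizedAction cs o w x}

end CoxeterForm

end

/-!
The form `B` is Lorentzian: it is negative on the eigenvector `o` and positive definite on the
hyperplane of vectors of height `0`. Hence two points `x`, `z` of the projected isotropic cone
satisfy `B(x, z) ≤ 0`, with equality only if `x = z`
(`CoxeterForm.eq_of_form_nonneg_of_mem_isotropic`, from `B(x - z, x - z) = -2 B(x, z)`). By a
Perron-Frobenius argument the coordinates of `o` have constant sign, and everything is equivariant
under `o ↦ -o`, so that they may be taken to be positive.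

The group theory enters through the fact that every root is positive or negative
(`CoxeterForm.rep_simpleRoot_nonneg`), proved by induction on the length with the dihedral case
given by Chebyshev polynomials. It implies that the representation is discrete: an element such that
it and its inverse are close to the identity has a nonnegative monomial matrix close to the
identity. So the positive roots do not accumulate, only finitely many of them have bounded height,
and limit roots are isotropic.

For a generating `I` and `x` isotropic in the span of `Δ_I`, consider the set of positive roots `ρ`
of `W_I` with `B(x, ρ) ≥ 0`. If it is infinite, a limit `z` of the normalized ones has
`B(x, z) ≥ 0`, so `z = x`, and `x` is a limit root of `W_I`. It is never finite: replacing `x` by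
`s i x` when `B(x, α i) > 0` lowers its cardinality, so one may assume `B(x, α i) ≤ 0` for all
`i ∈ I`. As `I` is generating, `x` has nonnegative coordinates, and `B(x, x) = 0` makes `x`
orthogonal to the simple roots in its support `J`. A positive root of maximal height in the span of
`Δ_J` would have nonnegative product with `Δ_J` and product zero with `x`, hence be orthogonal to
itself.

For the closure, reflecting a fixed isotropic point `y ≠ x` in roots whose normalizations converge
to the limit root `x` gives points converging to `x`, as the heights of the roots tend to infinity
(`CoxeterForm.mem_closure_of_mem_limitRoots`). So the closure of any nonempty stable subset of the
projected isotropic cone contains the limit roots, and the self-similar set is nonempty because a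
minimal `I` for which the form is not positive definite on the span of `Δ_I` is generating
(`CoxeterForm.exists_isGenerating_nonempty`).
-/

/-! ### Alternating words and Chebyshev polynomials -/

/-- An alternating word in `i`, `j` of length at least `M i j` that ends in `j` has the same product
as a word of the same length ending in `i`. -/
theorem CoxeterSystem.length_wordProd_alternatingWord_mul_lt {ι : Type*} {M : CoxeterMatrix ι}
    {W : Type*} [Group W] (cs : CoxeterSystem M W) {i j : ι} (hM : M i j ≠ 0) {m : ℕ}
    (hm : M i j ≤ m) :
    cs.length (cs.wordProd (alternatingWord i j m) * cs.simple i) < m := by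
  induction m, hm using Nat.le_induction with
  | base =>
    rw [cs.prod_alternatingWord_eq_prod_alternatingWord_sub i j (M i j) (by lia),
      show M i j * 2 - M i j = (M i j - 1) + 1 by lia, alternatingWord_succ, cs.wordProd_concat,
      cs.simple_mul_simple_cancel_right]
    have := cs.length_wordProd_le (alternatingWord i j (M i j - 1))
    rw [length_alternatingWord] at this
    lia
  | succ m hm ih =>
    rw [alternatingWord_succ', cs.wordProd_cons, mul_assoc]
    have := cs.length_mul_le (cs.simple (if Even m then j else i))
      (cs.wordProd (alternatingWord i j m) * cs.simple i)
    rw [cs.length_simple] at this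
    lia

namespace CoxeterForm

open Polynomial in
theorem chebyshev_S_nonneg_of_two_le {t : ℝ} (ht : 2 ≤ t) (k : ℕ) :
    0 ≤ (Chebyshev.S ℝ (k - 1)).eval t ∧
      (Chebyshev.S ℝ (k - 1)).eval t ≤ (Chebyshev.S ℝ k).eval t := by
  induction k with
  | zero => simp
  | succ k ih =>
    have h : (Chebyshev.S ℝ ((k + 1 : ℕ) : ℤ)).eval t =
        t * (Chebyshev.S ℝ k).eval t - (Chebyshev.S ℝ (k - 1)).eval t := by
      have := congrArg (Polynomial.eval t) (Chebyshev.S_add_two ℝ ((k : ℤ) - 1))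
      rw [show (k : ℤ) - 1 + 2 = ((k + 1 : ℕ) : ℤ) by push_cast; ring,
        show (k : ℤ) - 1 + 1 = k by ring] at this
      simpa using this
    rw [h, show ((k + 1 : ℕ) : ℤ) - 1 = k by push_cast; ring]
    constructor
    · linarith
    · nlinarith

open Polynomial in
theorem chebyshev_S_two_mul_cos_nonneg {m : ℕ} (hm : 2 ≤ m) {k : ℕ} (hk : k ≤ m) :
    0 ≤ (Chebyshev.S ℝ (k - 1)).eval (2 * Real.cos (Real.pi / m)) := by
  have hm0 : (0 : ℝ) < m := by exact_mod_cast (by lia : 0 < m)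
  have hm2 : (2 : ℝ) ≤ m := by exact_mod_cast hm
  have hsin : 0 < Real.sin (Real.pi / m) := by
    apply Real.sin_pos_of_pos_of_lt_pi (by positivity)
    rw [div_lt_iff₀ hm0]
    nlinarith [Real.pi_pos]
  have h := Chebyshev.S_two_mul_real_cos (Real.pi / m) ((k : ℤ) - 1)
  push_cast at h
  rw [sub_add_cancel] at h
  refine nonneg_of_mul_nonneg_left (b := Real.sin (Real.pi / m)) ?_ hsin
  rw [h]
  apply Real.sin_nonneg_of_nonneg_of_le_pi (by positivity)
  have : (k : ℝ) ≤ m := by exact_mod_cast hk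
  rw [mul_div_assoc', div_le_iff₀ hm0]
  nlinarith [Real.pi_pos]

theorem mat_nonpos {ι : Type*} {M : CoxeterMatrix ι} (B : CoxeterForm M) {i j : ι}
    (hij : i ≠ j) : B.mat i j ≤ 0 := by
  by_cases h0 : M i j = 0
  · linarith [B.apply_of_eq_zero i j h0]
  · rw [B.apply_of_ne_zero i j h0, neg_nonpos]
    have h1 := M.off_diagonal i j hij
    have h2 : (2 : ℝ) ≤ M i j := by exact_mod_cast (by lia : 2 ≤ M i j)
    apply Real.cos_nonneg_of_neg_pi_div_two_le_of_le
    · have := Real.pi_pos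
      have : 0 ≤ Real.pi / M i j := by positivity
      linarith
    · exact div_le_div_of_nonneg_left Real.pi_pos.le (by norm_num) h2

theorem chebyshev_coeff_nonneg {ι : Type*} {M : CoxeterMatrix ι} (B : CoxeterForm M)
    {i j : ι} (hij : i ≠ j) {k : ℕ}
    (hk : M i j ≠ 0 → k < M i j) :
    0 ≤ (Polynomial.Chebyshev.S ℝ k).eval (-2 * B.mat i j) ∧
      0 ≤ (Polynomial.Chebyshev.S ℝ (k - 1)).eval (-2 * B.mat i j) := by
  by_cases h0 : M i j = 0
  · have := chebyshev_S_nonneg_of_two_le (t := -2 * B.mat i j)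
      (by linarith [B.apply_of_eq_zero i j h0]) k
    exact ⟨this.1.trans this.2, this.1⟩
  · have h1 := M.off_diagonal i j hij
    have hkm := hk h0
    rw [B.apply_of_ne_zero i j h0, neg_mul_neg]
    refine ⟨?_, chebyshev_S_two_mul_cos_nonneg (by lia) hkm.le⟩
    have := chebyshev_S_two_mul_cos_nonneg (m := M i j) (by lia) (k := k + 1) hkm
    push_cast at this
    rwa [add_sub_cancel_right] at this

variable {ι : Type*} [Fintype ι] [DecidableEq ι] {M : CoxeterMatrix ι}
variable {W : Type*} [Group W]

theorem form_comm (B : CoxeterForm M) (x y : EuclideanSpace ℝ ι) : B.form x y = B.form y x := by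
  simp only [form, Matrix.toBilin_apply]
  rw [Finset.sum_comm]
  refine Finset.sum_congr rfl fun i _ ↦ Finset.sum_congr rfl fun j _ ↦ ?_
  rw [B.isSymm.apply i j]
  ring

theorem form_simpleRoot_left (B : CoxeterForm M) (i : ι) (y : EuclideanSpace ℝ ι) :
    B.form (simpleRoot i) y = ∑ j, B.mat i j * y j := by
  simp [form, Matrix.toBilin_apply, simpleRoot]

theorem form_eq_sum (B : CoxeterForm M) (x y : EuclideanSpace ℝ ι) :
    B.form x y = ∑ i, x i * B.form (simpleRoot i) y := by
  simp only [form_simpleRoot_left]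
  simp [form, Matrix.toBilin_apply, Finset.mul_sum, mul_assoc]

theorem form_simpleReflection (B : CoxeterForm M) (i : ι) (x y : EuclideanSpace ℝ ι) :
    B.form (B.simpleReflection i x) (B.simpleReflection i y) = B.form x y := by
  simp only [simpleReflection_apply, map_sub, map_smul, LinearMap.sub_apply, LinearMap.smul_apply,
    smul_eq_mul, form_simpleRoot, mat_self, B.form_comm x (simpleRoot i)]
  ring

theorem form_rep (B : CoxeterForm M) (cs : CoxeterSystem M W) (w : W)
    (x y : EuclideanSpace ℝ ι) : B.form (B.rep cs w x) (B.rep cs w y) = B.form x y := by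
  induction w using cs.simple_induction_left with
  | one => simp
  | mul_simple_left w i ih =>
    rw [map_mul, LinearEquiv.mul_apply, LinearEquiv.mul_apply, rep_simple, form_simpleReflection, ih]

theorem rep_inv_rep (B : CoxeterForm M) (cs : CoxeterSystem M W) (w : W)
    (x : EuclideanSpace ℝ ι) : B.rep cs w⁻¹ (B.rep cs w x) = x := by
  rw [← LinearEquiv.mul_apply, ← map_mul]; simp

theorem rep_rep_inv (B : CoxeterForm M) (cs : CoxeterSystem M W) (w : W)
    (x : EuclideanSpace ℝ ι) : B.rep cs w (B.rep cs w⁻¹ x) = x := by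
  rw [← LinearEquiv.mul_apply, ← map_mul]; simp

/-- The orbit of a simple root under a dihedral parabolic subgroup: the coefficients are values of
Chebyshev polynomials at `-2 B(α i, α j)`. -/
theorem rep_alternatingWord (B : CoxeterForm M) (cs : CoxeterSystem M W) (i j : ι) (k : ℕ) :
    B.rep cs (cs.wordProd (CoxeterSystem.alternatingWord i j k)) (simpleRoot i) =
      if Even k then
        (Polynomial.Chebyshev.S ℝ k).eval (-2 * B.mat i j) • simpleRoot i +
          (Polynomial.Chebyshev.S ℝ (k - 1)).eval (-2 * B.mat i j) • simpleRoot j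
      else
        (Polynomial.Chebyshev.S ℝ (k - 1)).eval (-2 * B.mat i j) • simpleRoot i +
          (Polynomial.Chebyshev.S ℝ k).eval (-2 * B.mat i j) • simpleRoot j := by
  induction k with
  | zero => simp [CoxeterSystem.alternatingWord]
  | succ k ih =>
    have hrec : (Polynomial.Chebyshev.S ℝ ((k + 1 : ℕ) : ℤ)).eval (-2 * B.mat i j) =
        -2 * B.mat i j * (Polynomial.Chebyshev.S ℝ k).eval (-2 * B.mat i j) -
          (Polynomial.Chebyshev.S ℝ (k - 1)).eval (-2 * B.mat i j) := by
      have := congrArg (Polynomial.eval (-2 * B.mat i j))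
        (Polynomial.Chebyshev.S_add_two ℝ ((k : ℤ) - 1))
      rw [show (k : ℤ) - 1 + 2 = ((k + 1 : ℕ) : ℤ) by push_cast; ring,
        show (k : ℤ) - 1 + 1 = k by ring] at this
      simpa using this
    have hsym : B.mat j i = B.mat i j := B.isSymm.apply i j
    rw [hrec, show ((k + 1 : ℕ) : ℤ) - 1 = k by push_cast; ring,
      CoxeterSystem.alternatingWord_succ', cs.wordProd_cons, map_mul, LinearEquiv.mul_apply, ih,
      rep_simple]
    by_cases hk : Even k
    · simp only [hk, if_true, Nat.even_add_one, not_true, if_false, simpleReflection_apply, map_add,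
        map_smul, form_simpleRoot, mat_self, hsym]
      module
    · simp only [hk, if_false, Nat.even_add_one, not_false_iff, if_true, simpleReflection_apply,
        map_add, map_smul, form_simpleRoot, mat_self]
      module

/-- If `s i` increases the length of `w`, then `w (α i)` is a positive root. Writing `w = v u` with
`u` the longest alternating suffix in `s i` and a descent `s j` of `w`, the vector `u (α i)` is a
nonnegative combination of `α i` and `α j`, which `v` maps to positive roots by induction. -/
theorem rep_simpleRoot_nonneg (B : CoxeterForm M) (cs : CoxeterSystem M W) (w : W) (i : ι)
    (hw : cs.length w < cs.length (w * cs.simple i)) (k : ι) :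
    0 ≤ B.rep cs w (simpleRoot i) k := by
  induction hn : cs.length w using Nat.strong_induction_on generalizing w i k with
  | _ n ih =>
  subst hn
  by_cases hw1 : w = 1
  · subst hw1
    by_cases hki : k = i <;> simp [simpleRoot, hki]
  obtain ⟨j, hj⟩ := cs.exists_rightDescent_of_ne_one hw1
  have hij : i ≠ j := by
    rintro rfl
    exact absurd hj (by simpa [CoxeterSystem.IsRightDescent] using hw.le)
  -- strip from `w` the longest possible alternating suffix in `i`, `j`
  let P : ℕ → Prop := fun k ↦ ∃ v : W,
    w = v * cs.wordProd (CoxeterSystem.alternatingWord i j k) ∧ cs.length v + k = cs.length w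
  have hP1 : P 1 := by
    refine ⟨w * cs.simple j, ?_, (cs.isRightDescent_iff.1 hj)⟩
    simp [CoxeterSystem.alternatingWord]
  obtain ⟨m, hm1, ⟨v, hwv, hlen⟩, hmax⟩ : ∃ m, 1 ≤ m ∧ P m ∧ ¬ P (m + 1) := by
    by_contra! hcon
    have : ∀ k, 1 ≤ k → P k := fun k hk ↦ Nat.le_induction hP1 (fun k hk h ↦ hcon k hk h) k hk
    obtain ⟨v, -, hv⟩ := this (cs.length w + 1) (by lia)
    lia
  -- both `s i` and `s j` increase the length of `v`: the first letter of the suffix since the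
  -- suffix is reduced in `w`, the other one by maximality
  have hlast (a : ι) (u : W)
      (hu : cs.wordProd (CoxeterSystem.alternatingWord i j m) = cs.simple a * u)
      (hul : cs.length u ≤ m - 1) : cs.length v < cs.length (v * cs.simple a) := by
    have h1 := cs.length_mul_le (v * cs.simple a) u
    rw [mul_assoc, ← hu, ← hwv] at h1
    lia
  have hnext : cs.length v < cs.length (v * cs.simple (if Even m then j else i)) := by
    by_contra hcon
    have h1 := (cs.length_mul_simple v (if Even m then j else i)).resolve_left (by lia)
    refine hmax ⟨v * cs.simple (if Even m then j else i), ?_, by lia⟩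
    rw [CoxeterSystem.alternatingWord_succ', cs.wordProd_cons, ← mul_assoc,
      cs.simple_mul_simple_cancel_right, hwv]
  have hfirst : cs.length v < cs.length (v * cs.simple (if Even m then i else j)) := by
    obtain ⟨m, rfl⟩ : ∃ m', m = m' + 1 := ⟨m - 1, by lia⟩
    have he : (if Even m then j else i) = (if Even (m + 1) then i else j) := by
      by_cases h : Even m <;> simp [h, Nat.even_add_one]
    refine hlast _ (cs.wordProd (CoxeterSystem.alternatingWord i j m)) ?_ ?_
    · rw [CoxeterSystem.alternatingWord_succ', cs.wordProd_cons, he]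
    · simpa using cs.length_wordProd_le (CoxeterSystem.alternatingWord i j m)
  have hvi : cs.length v < cs.length (v * cs.simple i) := by
    by_cases h : Even m <;> simp_all
  have hvj : cs.length v < cs.length (v * cs.simple j) := by
    by_cases h : Even m <;> simp_all
  -- a suffix of full length `M i j` could be rewritten to end in `s i`
  have hmM : M i j ≠ 0 → m < M i j := by
    intro hM
    by_contra! hle
    have h1 := cs.length_wordProd_alternatingWord_mul_lt hM hle
    have h2 := cs.length_mul_le v (cs.wordProd (CoxeterSystem.alternatingWord i j m) * cs.simple i)
    rw [← mul_assoc, ← hwv] at h2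
    lia
  obtain ⟨hc1, hc2⟩ := B.chebyshev_coeff_nonneg hij hmM
  have h1 := ih _ (by lia) v i hvi k rfl
  have h2 := ih _ (by lia) v j hvj k rfl
  rw [hwv, map_mul, LinearEquiv.mul_apply, rep_alternatingWord]
  split_ifs
  · simp only [map_add, map_smul, PiLp.add_apply, PiLp.smul_apply, smul_eq_mul]
    positivity
  · simp only [map_add, map_smul, PiLp.add_apply, PiLp.smul_apply, smul_eq_mul]
    positivity

end CoxeterForm

/-! ### Accumulation points -/

theorem mem_accumulationPoints_iff_accPt {X : Type*} [MetricSpace X] {A : Set X} {x : X} :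
    x ∈ accumulationPoints A ↔ AccPt x (𝓟 A) := by
  constructor
  · rintro ⟨u, hu, huA, hux⟩
    rw [accPt_iff_frequently]
    have h : ∀ᶠ k in atTop, u k ≠ x := by
      rw [← Nat.cofinite_eq_atTop]
      exact hu.tendsto_cofinite.eventually (eventually_cofinite_ne x)
    exact hux.frequently (h.mono fun k hk ↦ ⟨hk, huA k⟩).frequently
  · intro h
    have : (𝓝[≠] x ⊓ 𝓟 A).NeBot := h
    obtain ⟨u, hu⟩ := exists_seq_tendsto (𝓝[≠] x ⊓ 𝓟 A)
    obtain ⟨hux, huA⟩ := tendsto_inf.1 hu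
    obtain ⟨hux, hne⟩ := tendsto_nhdsWithin_iff.1 hux
    rw [tendsto_principal] at huA
    obtain ⟨N, hN⟩ := eventually_atTop.1 (hne.and huA)
    have hd : Tendsto (fun k ↦ (dist (u (k + N)) x)⁻¹) atTop atTop := by
      apply Tendsto.inv_tendsto_nhdsGT_zero
      rw [tendsto_nhdsWithin_iff]
      refine ⟨?_, Eventually.of_forall fun k ↦ dist_pos.2 (hN (k + N) (by lia)).1⟩
      rw [← tendsto_iff_dist_tendsto_zero]
      exact hux.comp (tendsto_add_atTop_nat N)
    obtain ⟨φ, hφ, hφ'⟩ := strictMono_subseq_of_tendsto_atTop hd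
    refine ⟨fun k ↦ u (φ k + N), fun a b hab ↦ hφ'.injective ?_, fun k ↦ (hN _ (by lia)).2, ?_⟩
    · simp only [Function.comp_apply]
      rw [show u (φ a + N) = u (φ b + N) from hab]
    · exact hux.comp ((tendsto_add_atTop_nat N).comp hφ.tendsto_atTop)

theorem isClosed_accumulationPoints {X : Type*} [MetricSpace X] (A : Set X) :
    IsClosed (accumulationPoints A) := by
  have : accumulationPoints A = derivedSet A := by
    ext x
    exact mem_accumulationPoints_iff_accPt
  rw [this]
  exact isClosed_derivedSet A

theorem accumulationPoints_mono {X : Type*} [TopologicalSpace X] {A A' : Set X} (h : A ⊆ A') :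
    accumulationPoints A ⊆ accumulationPoints A' :=
  fun _ ⟨u, hu, hA, hx⟩ ↦ ⟨u, hu, fun k ↦ h (hA k), hx⟩

/-- An infinite set in a compact set has an accumulation point. -/
theorem Set.Infinite.exists_mem_accumulationPoints {X : Type*} [MetricSpace X] {A K : Set X}
    (hA : A.Infinite) (hK : IsCompact K) (hAK : A ⊆ K) : ∃ x, x ∈ accumulationPoints A := by
  obtain ⟨x, -, hx⟩ := hA.exists_accPt_of_subset_isCompact hK hAK
  exact ⟨x, mem_accumulationPoints_iff_accPt.2 hx⟩

/-! ### The height -/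

section Height

variable {ι : Type*} [Fintype ι] (o : EuclideanSpace ℝ ι)

theorem height_add (v v' : EuclideanSpace ℝ ι) :
    height o (v + v') = height o v + height o v' := by
  simp [height, mul_add, Finset.sum_add_distrib]

theorem height_smul (c : ℝ) (v : EuclideanSpace ℝ ι) : height o (c • v) = c * height o v := by
  simp only [height, Finset.mul_sum, PiLp.smul_apply, smul_eq_mul]
  exact Finset.sum_congr rfl fun i _ ↦ by ring

theorem height_neg (v : EuclideanSpace ℝ ι) : height o (-v) = -height o v := by
  simp [height]

theorem height_sub (v v' : EuclideanSpace ℝ ι) :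
    height o (v - v') = height o v - height o v' := by
  rw [sub_eq_add_neg, height_add, height_neg, sub_eq_add_neg]

@[simp]
theorem height_zero : height o 0 = 0 := by simp [height]

theorem height_simpleRoot [DecidableEq ι] (i : ι) : height o (simpleRoot i) = o i := by
  simp [height, simpleRoot]

@[fun_prop]
theorem continuous_height : Continuous (height o) := by
  unfold height
  fun_prop

theorem normalized_smul {c : ℝ} (hc : c ≠ 0) (v : EuclideanSpace ℝ ι) :
    normalized o (c • v) = normalized o v := by
  simp only [normalized, height_smul, smul_smul, mul_inv]
  congr 1
  field_simp

theorem normalized_eq_self {v : EuclideanSpace ℝ ι} (hv : height o v = 1) :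
    normalized o v = v := by
  simp [normalized, hv]

theorem height_normalized {v : EuclideanSpace ℝ ι} (hv : height o v ≠ 0) :
    height o (normalized o v) = 1 := by
  rw [normalized, height_smul, inv_mul_cancel₀ hv]

theorem continuousAt_normalized {v : EuclideanSpace ℝ ι} (hv : height o v ≠ 0) :
    ContinuousAt (normalized o) v :=
  ((continuous_height o).continuousAt.inv₀ hv).smul continuousAt_id

/-- Nonnegative vectors of bounded height form a bounded set, if the height is positive. -/
theorem exists_isCompact_of_height_le {o : EuclideanSpace ℝ ι} (ho : ∀ i, 0 < o i) (H : ℝ) :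
    ∃ K : Set (EuclideanSpace ℝ ι), IsCompact K ∧
      {v | (∀ k, 0 ≤ v k) ∧ height o v ≤ H} ⊆ K := by
  refine ⟨WithLp.toLp 2 '' Set.pi Set.univ fun k ↦ Set.Icc 0 (H / o k), ?_, ?_⟩
  · exact (isCompact_univ_pi fun k ↦ isCompact_Icc).image (PiLp.continuous_toLp 2 _)
  · rintro v ⟨hv, hvH⟩
    refine ⟨v.ofLp, fun k _ ↦ ⟨hv k, ?_⟩, rfl⟩
    rw [le_div_iff₀ (ho k), mul_comm]
    refine le_trans ?_ hvH
    exact Finset.single_le_sum (f := fun k ↦ o k * v k)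
      (fun i _ ↦ mul_nonneg (ho i).le (hv i)) (Finset.mem_univ k)

theorem height_pos_of_nonneg {o : EuclideanSpace ℝ ι} (ho : ∀ i, 0 < o i)
    {v : EuclideanSpace ℝ ι} (hv : ∀ k, 0 ≤ v k) (hv0 : v ≠ 0) : 0 < height o v := by
  obtain ⟨k, hk⟩ : ∃ k, v k ≠ 0 := by
    by_contra! h
    exact hv0 (by ext k; simpa using h k)
  exact Finset.sum_pos' (fun i _ ↦ mul_nonneg (ho i).le (hv i))
    ⟨k, Finset.mem_univ k, mul_pos (ho k) (lt_of_le_of_ne (hv k) (Ne.symm hk))⟩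

end Height

theorem eq_sum_smul_simpleRoot {ι : Type*} [Fintype ι] [DecidableEq ι]
    (v : EuclideanSpace ℝ ι) : v = ∑ i, v i • simpleRoot i := by
  ext k
  simp [simpleRoot, Pi.single_apply]

theorem simpleRoot_self {ι : Type*} [DecidableEq ι] (i : ι) :
    (simpleRoot i : EuclideanSpace ℝ ι) i = 1 := by
  simp [simpleRoot]

theorem simpleRoot_of_ne {ι : Type*} [DecidableEq ι] {i k : ι} (h : k ≠ i) :
    (simpleRoot i : EuclideanSpace ℝ ι) k = 0 := by
  simp [simpleRoot, h]

theorem simpleRoot_nonneg {ι : Type*} [DecidableEq ι] (i k : ι) :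
    0 ≤ (simpleRoot i : EuclideanSpace ℝ ι) k := by
  by_cases hk : k = i
  · rw [hk, simpleRoot_self]
    exact zero_le_one
  · rw [simpleRoot_of_ne hk]

theorem mem_span_simpleRoots {ι : Type*} [Fintype ι] [DecidableEq ι] {I : Set ι}
    {v : EuclideanSpace ℝ ι} :
    v ∈ Submodule.span ℝ (simpleRoots I) ↔ ∀ k ∉ I, v k = 0 := by
  constructor
  · intro h k hk
    induction h using Submodule.span_induction with
    | mem x hx =>
      obtain ⟨i, hi, rfl⟩ := hx
      exact simpleRoot_of_ne (by rintro rfl; exact hk hi)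
    | zero => simp
    | add x y _ _ hx hy => simp [hx, hy]
    | smul c x _ hx => simp [hx]
  · intro h
    rw [eq_sum_smul_simpleRoot v]
    refine Submodule.sum_mem _ fun i _ ↦ ?_
    by_cases hi : i ∈ I
    · exact Submodule.smul_mem _ _ (Submodule.subset_span ⟨i, hi, rfl⟩)
    · simp [h i hi]

namespace CoxeterForm

/-! ### Positive roots and discreteness of the root system -/

variable {ι : Type*} [Fintype ι] [DecidableEq ι] {M : CoxeterMatrix ι}
variable {W : Type*} [Group W]

@[fun_prop]
theorem continuous_form (B : CoxeterForm M) {X : Type*} [TopologicalSpace X]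
    {f g : X → EuclideanSpace ℝ ι} (hf : Continuous f) (hg : Continuous g) :
    Continuous fun x ↦ B.form (f x) (g x) := by
  have h (x) : B.form (f x) (g x) = ∑ i, f x i * ∑ j, B.mat i j * g x j := by
    simp only [B.form_eq_sum (f x), form_simpleRoot_left]
  simp only [h]
  fun_prop

theorem form_self_of_mem_roots (B : CoxeterForm M) (cs : CoxeterSystem M W)
    {ρ : EuclideanSpace ℝ ι} (hρ : ρ ∈ B.roots cs) : B.form ρ ρ = 1 := by
  obtain ⟨w, i, rfl⟩ := hρ
  rw [form_rep, form_simpleRoot, mat_self]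

theorem ne_zero_of_mem_roots (B : CoxeterForm M) (cs : CoxeterSystem M W)
    {ρ : EuclideanSpace ℝ ι} (hρ : ρ ∈ B.roots cs) : ρ ≠ 0 := by
  rintro rfl
  simpa using B.form_self_of_mem_roots cs hρ

theorem rep_mem_roots (B : CoxeterForm M) (cs : CoxeterSystem M W)
    {ρ : EuclideanSpace ℝ ι} (hρ : ρ ∈ B.roots cs) (w : W) : B.rep cs w ρ ∈ B.roots cs := by
  obtain ⟨w', i, rfl⟩ := hρ
  exact ⟨w * w', i, by rw [map_mul, LinearEquiv.mul_apply]⟩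

theorem simpleRoot_mem_roots (B : CoxeterForm M) (cs : CoxeterSystem M W) (i : ι) :
    simpleRoot i ∈ B.roots cs := ⟨1, i, by simp⟩

theorem simpleReflection_simpleRoot (B : CoxeterForm M) (i : ι) :
    B.simpleReflection i (simpleRoot i) = -simpleRoot i := by
  rw [simpleReflection_apply, form_simpleRoot, mat_self]
  module

theorem neg_mem_roots (B : CoxeterForm M) (cs : CoxeterSystem M W)
    {ρ : EuclideanSpace ℝ ι} (hρ : ρ ∈ B.roots cs) : -ρ ∈ B.roots cs := by
  obtain ⟨w, i, rfl⟩ := hρ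
  refine ⟨w * cs.simple i, i, ?_⟩
  rw [map_mul, LinearEquiv.mul_apply, rep_simple, simpleReflection_simpleRoot, map_neg]

/-- Every root is positive or negative. -/
theorem nonneg_or_nonpos_of_mem_roots (B : CoxeterForm M) (cs : CoxeterSystem M W)
    {ρ : EuclideanSpace ℝ ι} (hρ : ρ ∈ B.roots cs) : (∀ k, 0 ≤ ρ k) ∨ ∀ k, ρ k ≤ 0 := by
  obtain ⟨w, i, rfl⟩ := hρ
  rcases cs.length_mul_simple w i with h | h
  · exact Or.inl (B.rep_simpleRoot_nonneg cs w i (by lia))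
  · refine Or.inr fun k ↦ ?_
    have := B.rep_simpleRoot_nonneg cs (w * cs.simple i) i
      (by rw [cs.simple_mul_simple_cancel_right]; lia) k
    rw [map_mul, LinearEquiv.mul_apply, rep_simple, simpleReflection_simpleRoot, map_neg] at this
    simpa using this

theorem nonneg_of_mem_roots (B : CoxeterForm M) (cs : CoxeterSystem M W)
    {ρ : EuclideanSpace ℝ ι} (hρ : ρ ∈ B.roots cs) {k : ι} (hk : 0 < ρ k) (l : ι) : 0 ≤ ρ l := by
  rcases B.nonneg_or_nonpos_of_mem_roots cs hρ with h | h
  · exact h l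
  · exact absurd (h k) (not_le.2 hk)

/-- Proportional positive roots are equal. -/
theorem eq_of_eq_smul (B : CoxeterForm M) (cs : CoxeterSystem M W)
    {ρ ρ' : EuclideanSpace ℝ ι} (hρ : ρ ∈ B.roots cs) (hρ' : ρ' ∈ B.roots cs)
    (h : ∀ k, 0 ≤ ρ k) (h' : ∀ k, 0 ≤ ρ' k) {c : ℝ} (hc : ρ = c • ρ') : ρ = ρ' := by
  have h1 := B.form_self_of_mem_roots cs hρ
  rw [hc, map_smul, map_smul, LinearMap.smul_apply, B.form_self_of_mem_roots cs hρ', smul_eq_mul,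
    smul_eq_mul, mul_one] at h1
  rcases mul_self_eq_one_iff.1 h1 with rfl | rfl
  · simpa using hc
  · refine absurd ?_ (B.ne_zero_of_mem_roots cs hρ)
    ext k
    have h2 := congrArg (fun v ↦ v k) hc
    simp only [neg_smul, one_smul, PiLp.neg_apply] at h2
    have := h k
    have := h' k
    simp only [PiLp.zero_apply]
    linarith

/-- The reflection in a root is the image of an element of the Coxeter group. -/
theorem exists_rep_eq_reflection (B : CoxeterForm M) (cs : CoxeterSystem M W)
    {ρ : EuclideanSpace ℝ ι} (hρ : ρ ∈ B.roots cs) :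
    ∃ t : W, ∀ v, B.rep cs t v = v - (2 * B.form ρ v) • ρ := by
  obtain ⟨w, i, rfl⟩ := hρ
  refine ⟨w * cs.simple i * w⁻¹, fun v ↦ ?_⟩
  rw [map_mul, map_mul, LinearEquiv.mul_apply, LinearEquiv.mul_apply, rep_simple,
    simpleReflection_apply, map_sub, map_smul, rep_rep_inv]
  congr 3
  rw [← B.form_rep cs w, rep_rep_inv]

/-- An element `w` of `W` such that the matrices of `w` and `w⁻¹` have positive diagonal acts
trivially: as roots are positive or negative, both matrices are nonnegative, so they are monomial.
In particular the image of `W` in the general linear group is discrete. -/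
theorem rep_simpleRoot_eq_self (B : CoxeterForm M) (cs : CoxeterSystem M W) {w : W}
    (h1 : ∀ i, 0 < B.rep cs w (simpleRoot i) i) (h2 : ∀ i, 0 < B.rep cs w⁻¹ (simpleRoot i) i)
    (i : ι) : B.rep cs w (simpleRoot i) = simpleRoot i := by
  have hp (i) : ∀ k, 0 ≤ B.rep cs w (simpleRoot i) k :=
    B.nonneg_of_mem_roots cs ⟨w, i, rfl⟩ (h1 i)
  have hp' (i) : ∀ k, 0 ≤ B.rep cs w⁻¹ (simpleRoot i) k :=
    B.nonneg_of_mem_roots cs ⟨w⁻¹, i, rfl⟩ (h2 i)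
  have h0 (j : ι) (hj : j ≠ i) : B.rep cs w (simpleRoot i) j = 0 := by
    have h3 : B.rep cs w⁻¹ (B.rep cs w (simpleRoot i)) j = 0 := by
      rw [rep_inv_rep, simpleRoot_of_ne hj]
    rw [eq_sum_smul_simpleRoot (B.rep cs w (simpleRoot i)), map_sum] at h3
    simp only [map_smul, WithLp.ofLp_sum, Finset.sum_apply, PiLp.smul_apply, smul_eq_mul] at h3
    have h4 := (Finset.sum_eq_zero_iff_of_nonneg
      fun l _ ↦ mul_nonneg (hp i l) (hp' l j)).1 h3 j (Finset.mem_univ j)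
    exact (mul_eq_zero.1 h4).resolve_right (h2 j).ne'
  refine B.eq_of_eq_smul cs ⟨w, i, rfl⟩ (B.simpleRoot_mem_roots cs i) (hp i)
    (simpleRoot_nonneg i) (c := B.rep cs w (simpleRoot i) i) ?_
  ext k
  by_cases hk : k = i
  · rw [hk, PiLp.smul_apply, simpleRoot_self, smul_eq_mul, mul_one]
  · rw [h0 k hk, PiLp.smul_apply, simpleRoot_of_ne hk, smul_zero]

/-- A convergent injective sequence of positive roots `ρ k` cannot exist: the products of the
reflections in `ρ k` and `ρ (k + 1)` would tend to the identity. -/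
theorem accumulationPoints_posRoots (B : CoxeterForm M) (cs : CoxeterSystem M W) :
    accumulationPoints {ρ ∈ B.roots cs | ∀ k, 0 ≤ ρ k} = ∅ := by
  rw [Set.eq_empty_iff_forall_notMem]
  rintro x ⟨u, hu, huA, hux⟩
  have hxx : B.form x x = 1 := by
    have h1 : Tendsto (fun k ↦ B.form (u k) (u k)) atTop (𝓝 (B.form x x)) :=
      ((B.continuous_form continuous_id continuous_id).tendsto x).comp hux
    refine tendsto_nhds_unique h1 ?_
    simp only [B.form_self_of_mem_roots cs (huA _).1]
    exact tendsto_const_nhds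
  choose t ht using fun k ↦ B.exists_rep_eq_reflection cs (huA k).1
  have htt (k) (v) : B.rep cs (t k) (B.rep cs (t k) v) = v := by
    simp only [ht, map_sub, map_smul, B.form_self_of_mem_roots cs (huA k).1, smul_eq_mul]
    module
  -- the product of two reflections, as a continuous function of the two roots
  let F : ι → EuclideanSpace ℝ ι × EuclideanSpace ℝ ι → ℝ := fun i p ↦
    (simpleRoot i - (2 * B.form p.2 (simpleRoot i)) • p.2 -
      (2 * B.form p.1 (simpleRoot i - (2 * B.form p.2 (simpleRoot i)) • p.2)) • p.1) i
  have hF (i) : Continuous (F i) := by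
    simp only [F, PiLp.sub_apply, PiLp.smul_apply]
    fun_prop
  have hFx (i) : F i (x, x) = 1 := by
    have : simpleRoot i - (2 * B.form x (simpleRoot i)) • x -
      (2 * B.form x (simpleRoot i - (2 * B.form x (simpleRoot i)) • x)) • x = simpleRoot i := by
      simp only [map_sub, map_smul, hxx, smul_eq_mul]
      module
    simp only [F, this, simpleRoot_self]
  have hux' := hux.comp (tendsto_add_atTop_nat 1)
  have hev (a b : ℕ → EuclideanSpace ℝ ι) (ha : Tendsto a atTop (𝓝 x))
      (hb : Tendsto b atTop (𝓝 x)) : ∀ᶠ k in atTop, ∀ i, 0 < F i (a k, b k) := by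
    rw [eventually_all]
    intro i
    have h1 : Tendsto (fun k ↦ F i (a k, b k)) atTop (𝓝 1) := by
      rw [← hFx i]
      exact ((hF i).tendsto (x, x)).comp (ha.prodMk_nhds hb)
    exact h1.eventually (lt_mem_nhds zero_lt_one)
  obtain ⟨k, hk1, hk2⟩ := ((hev u _ hux hux').and (hev _ u hux' hux)).exists
  have hinv (v) : B.rep cs (t k * t (k + 1))⁻¹ v = B.rep cs (t (k + 1)) (B.rep cs (t k) v) := by
    conv_lhs => rw [← htt k v, ← htt (k + 1) (B.rep cs (t k) v)]
    rw [← LinearEquiv.mul_apply (B.rep cs (t k)), ← map_mul, rep_inv_rep]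
  have hid := B.rep_simpleRoot_eq_self cs (w := t k * t (k + 1))
    (fun i ↦ by rw [map_mul, LinearEquiv.mul_apply, ht, ht]; exact hk1 i)
    (fun i ↦ by rw [hinv, ht, ht]; exact hk2 i)
  have hid' (v) : B.rep cs (t k * t (k + 1)) v = v := by
    rw [eq_sum_smul_simpleRoot v, map_sum]
    simp only [map_smul, hid]
  have h3 : B.rep cs (t k) (u (k + 1)) = -u (k + 1) := by
    have h4 := hid' (u (k + 1))
    rw [map_mul, LinearEquiv.mul_apply, ht (k + 1), B.form_self_of_mem_roots cs (huA _).1,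
      show u (k + 1) - (2 * 1 : ℝ) • u (k + 1) = -u (k + 1) by module, map_neg] at h4
    rw [← h4, neg_neg, h4]
  rw [ht] at h3
  have h5 : u (k + 1) = B.form (u k) (u (k + 1)) • u k := by
    have : (2 : ℝ) • u (k + 1) = (2 : ℝ) • B.form (u k) (u (k + 1)) • u k := by
      rw [← sub_eq_zero] at h3 ⊢
      rw [← h3]
      module
    exact smul_right_injective _ (two_ne_zero (α := ℝ)) this
  have := hu (B.eq_of_eq_smul cs (huA _).1 (huA _).1 (huA _).2 (huA _).2 h5)
  lia

/-- There are only finitely many positive roots of bounded height. -/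
theorem finite_posRoots_height_le (B : CoxeterForm M) (cs : CoxeterSystem M W)
    {o : EuclideanSpace ℝ ι} (ho : ∀ i, 0 < o i) (H : ℝ) :
    {ρ ∈ B.roots cs | (∀ k, 0 ≤ ρ k) ∧ height o ρ ≤ H}.Finite := by
  by_contra hinf
  obtain ⟨K, hK, hsub⟩ := exists_isCompact_of_height_le ho H
  obtain ⟨x, hx⟩ := Set.Infinite.exists_mem_accumulationPoints hinf hK
    fun ρ hρ ↦ hsub hρ.2
  have : x ∈ accumulationPoints {ρ ∈ B.roots cs | ∀ k, 0 ≤ ρ k} := by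
    refine accumulationPoints_mono ?_ hx
    exact fun ρ hρ ↦ ⟨hρ.1, hρ.2.1⟩
  rw [accumulationPoints_posRoots] at this
  exact this

end CoxeterForm

namespace CoxeterForm

/-! ### Lorentzian geometry of the form -/

theorem IsNegativeUnitEigenvector.height_self {ι : Type*} [Fintype ι] {M : CoxeterMatrix ι}
    {B : CoxeterForm M} {o : EuclideanSpace ℝ ι} (ho : B.IsNegativeUnitEigenvector o) :
    height o o = 1 := by
  have h := EuclideanSpace.real_norm_sq_eq o
  rw [ho.1] at h
  simp only [height, ← sq]
  linarith

theorem IsNegativeUnitEigenvector.neg {ι : Type*} [Fintype ι] {M : CoxeterMatrix ι}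
    {B : CoxeterForm M} {o : EuclideanSpace ℝ ι} (ho : B.IsNegativeUnitEigenvector o) :
    B.IsNegativeUnitEigenvector (-o) := by
  obtain ⟨h1, c, hc, h⟩ := ho
  refine ⟨by rwa [norm_neg], c, hc, fun i ↦ ?_⟩
  simp [h i]

variable {ι : Type*} [Fintype ι] [DecidableEq ι] {M : CoxeterMatrix ι}
variable {W : Type*} [Group W]

/-- The form is positive definite on the hyperplane of vectors of height `0`. -/
def PosDefOnHeightZero (B : CoxeterForm M) (o : EuclideanSpace ℝ ι) : Prop :=
  ∀ u, height o u = 0 → u ≠ 0 → 0 < B.form u u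

/-- The decomposition of a vector into its positive and negative parts. -/
theorem exists_eq_sub_nonneg {ι : Type*} (v : EuclideanSpace ℝ ι) :
    ∃ p q : EuclideanSpace ℝ ι, v = p - q ∧ (∀ k, p k = max (v k) 0) ∧
      ∀ k, q k = max (-v k) 0 := by
  refine ⟨WithLp.toLp 2 fun k ↦ max (v k) 0, WithLp.toLp 2 fun k ↦ max (-v k) 0, ?_,
    fun _ ↦ rfl, fun _ ↦ rfl⟩
  ext k
  simp only [PiLp.sub_apply]
  rcases le_total (v k) 0 with h | h <;> simp [h]

theorem form_nonpos_of_disjoint (B : CoxeterForm M) {p q : EuclideanSpace ℝ ι}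
    (hp : ∀ k, 0 ≤ p k) (hq : ∀ k, 0 ≤ q k) (hpq : ∀ k, p k * q k = 0) : B.form p q ≤ 0 := by
  simp only [B.form_eq_sum p, form_simpleRoot_left, Finset.mul_sum]
  refine Finset.sum_nonpos fun i _ ↦ Finset.sum_nonpos fun j _ ↦ ?_
  by_cases hij : i = j
  · subst hij
    rw [mul_left_comm, hpq, mul_zero]
  · rw [mul_left_comm]
    exact mul_nonpos_of_nonpos_of_nonneg (B.mat_nonpos hij) (mul_nonneg (hp i) (hq j))

section Eigenvector

variable {B : CoxeterForm M} {o : EuclideanSpace ℝ ι}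

theorem IsNegativeUnitEigenvector.exists_form_eq (ho : B.IsNegativeUnitEigenvector o) :
    ∃ c < 0, ∀ v, B.form v o = c * height o v := by
  obtain ⟨-, c, hc, h⟩ := ho
  refine ⟨c, hc, fun v ↦ ?_⟩
  rw [form_eq_sum, height, Finset.mul_sum]
  refine Finset.sum_congr rfl fun i _ ↦ ?_
  rw [form_simpleRoot_left, h]
  ring

theorem IsNegativeUnitEigenvector.posDefOnHeightZero (ho : B.IsNegativeUnitEigenvector o)
    (hsig : B.HasSignature (Fintype.card ι - 1) 1) : B.PosDefOnHeightZero o := by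
  intro u hu hu0
  by_contra! hneg
  obtain ⟨c, hc, hco⟩ := ho.exists_form_eq
  have hind : LinearIndependent ℝ ![o, u] := by
    rw [LinearIndependent.pair_iff]
    intro a b hab
    have h := congrArg (height o) hab
    rw [height_add, height_smul, height_smul, hu, ho.height_self, height_zero] at h
    have ha : a = 0 := by linarith
    refine ⟨ha, ?_⟩
    rw [ha, zero_smul, zero_add] at hab
    exact (smul_eq_zero.1 hab).resolve_right hu0
  have hfin : Module.finrank ℝ (Submodule.span ℝ (Set.range ![o, u])) = 2 := by
    simpa using finrank_span_eq_card hind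
  have hnp : ∀ x ∈ Submodule.span ℝ (Set.range ![o, u]), B.form.toQuadraticMap x ≤ 0 := by
    intro x hx
    rw [Matrix.range_cons, Matrix.range_cons, Matrix.range_empty, Set.union_empty,
      Set.singleton_union, Submodule.mem_span_pair] at hx
    obtain ⟨a, b, rfl⟩ := hx
    have h1 : B.form u o = 0 := by rw [hco, hu, mul_zero]
    have h2 : B.form o u = 0 := by rw [form_comm, h1]
    have h3 : B.form o o = c := by rw [hco, ho.height_self, mul_one]
    simp only [LinearMap.BilinMap.toQuadraticMap_apply, map_add, map_smul, LinearMap.add_apply,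
      LinearMap.smul_apply, h1, h2, h3, smul_eq_mul]
    nlinarith [mul_nonneg (sq_nonneg a) (neg_nonneg.2 hc.le),
      mul_nonneg (sq_nonneg b) (neg_nonneg.2 hneg)]
  have h := QuadraticForm.sigPos_add_finrank_le_of_nonpos hnp
  rw [hsig.1, hfin, finrank_euclideanSpace] at h
  lia

/-- In an irreducible form, a nonnegative eigenvector is positive. -/
theorem IsNegativeUnitEigenvector.pos_of_nonneg (ho : B.IsNegativeUnitEigenvector o)
    (hirr : B.IsIrreducible) (hnn : ∀ i, 0 ≤ o i) (i : ι) : 0 < o i := by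
  obtain ⟨-, c, hc, h⟩ := id ho
  by_contra hi
  have hi0 : o i = 0 := le_antisymm (not_lt.1 hi) (hnn i)
  have hne : ∃ j, o j ≠ 0 := by
    by_contra! h0
    have := ho.height_self
    simp [height, h0] at this
  obtain ⟨k, hk, l, hl, hkl⟩ := hirr {k | o k = 0} ⟨i, hi0⟩ hne
  replace hk : o k = 0 := hk
  have h1 := h k
  rw [hk, mul_zero] at h1
  refine mul_ne_zero hkl hl ((Finset.sum_eq_zero_iff_of_nonpos fun j _ ↦ ?_).1 h1 l
    (Finset.mem_univ l))
  by_cases hj : k = j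
  · rw [← hj, hk, mul_zero]
  · exact mul_nonpos_of_nonpos_of_nonneg (B.mat_nonpos hj) (hnn j)

/-- Perron-Frobenius: the eigenvector of an irreducible form for the negative eigenvalue has
nonzero coordinates of constant sign. Its positive and negative parts would otherwise be timelike
vectors `p`, `q` of positive and negative height, with `B(p, q) ≤ 0`, and some positive combination
of them would be a timelike vector of height `0`. -/
theorem IsNegativeUnitEigenvector.pos_or_neg (ho : B.IsNegativeUnitEigenvector o)
    (hirr : B.IsIrreducible) (hsig : B.HasSignature (Fintype.card ι - 1) 1) :
    (∀ i, 0 < o i) ∨ ∀ i, 0 < (-o) i := by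
  have hL := ho.posDefOnHeightZero hsig
  obtain ⟨c, hc, hco⟩ := ho.exists_form_eq
  obtain ⟨p, q, hopq, hp, hq⟩ := exists_eq_sub_nonneg o
  have hp0 (k) : 0 ≤ p k := (le_max_right _ _).trans_eq (hp k).symm
  have hq0 (k) : 0 ≤ q k := (le_max_right _ _).trans_eq (hq k).symm
  have hpq (k) : p k * q k = 0 := by
    rw [hp, hq]
    rcases le_total (o k) 0 with h | h <;> simp [h]
  by_cases hpz : ∀ k, o k ≤ 0
  · exact Or.inr (ho.neg.pos_of_nonneg hirr fun k ↦ by simpa using hpz k)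
  by_cases hqz : ∀ k, 0 ≤ o k
  · exact Or.inl (ho.pos_of_nonneg hirr hqz)
  exfalso
  push Not at hpz hqz
  obtain ⟨a, ha⟩ := hpz
  obtain ⟨b, hb⟩ := hqz
  have hhp : 0 < height o p := by
    refine Finset.sum_pos' (fun k _ ↦ ?_) ⟨a, Finset.mem_univ a, ?_⟩
    · rw [hp]
      rcases le_total (o k) 0 with h | h <;> simp [h, mul_nonneg]
    · rw [hp, max_eq_left ha.le]
      exact mul_pos ha ha
  have hhq : height o q < 0 := by
    refine Finset.sum_neg' (fun k _ ↦ ?_) ⟨b, Finset.mem_univ b, ?_⟩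
    · rw [hq]
      rcases le_total (o k) 0 with h | h
      · simpa [h] using mul_self_nonneg (o k)
      · simp [h]
    · rw [hq, max_eq_left (by linarith)]
      nlinarith
  have hBpq := B.form_nonpos_of_disjoint hp0 hq0 hpq
  have hBp : B.form p p = c * height o p + B.form p q := by
    have h := congrArg (B.form p) hopq
    rw [map_sub] at h
    rw [← hco, h, sub_add_cancel]
  have hBq : B.form q q = B.form p q - c * height o q := by
    have h := congrArg (B.form q) hopq
    rw [map_sub] at h
    rw [← hco, h, B.form_comm q p, sub_sub_cancel]
  have hBp' : B.form p p < 0 := by nlinarith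
  have hBq' : B.form q q < 0 := by nlinarith
  have hz : height o ((-height o q) • p + height o p • q) = 0 := by
    rw [height_add, height_smul, height_smul]
    ring
  have hzz : B.form ((-height o q) • p + height o p • q) ((-height o q) • p + height o p • q)
      < 0 := by
    simp only [map_add, map_smul, LinearMap.add_apply, LinearMap.smul_apply, smul_eq_mul,
      B.form_comm q p]
    have h1 := mul_pos_of_neg_of_neg hhq hhq
    have h2 := mul_pos hhp hhp
    have h3 := mul_neg_of_pos_of_neg h1 hBp'
    have h4 := mul_neg_of_pos_of_neg h2 hBq'
    have h5 := mul_nonpos_of_nonneg_of_nonpos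
      (mul_pos (neg_pos.2 hhq) hhp).le hBpq
    linarith
  refine (hL _ hz ?_).not_gt hzz
  intro h
  rw [h] at hzz
  simp at hzz

end Eigenvector

theorem height_ne_zero (B : CoxeterForm M) {o x : EuclideanSpace ℝ ι}
    (hL : B.PosDefOnHeightZero o) (hx : B.form x x = 0) (hx0 : x ≠ 0) : height o x ≠ 0 :=
  fun h ↦ (hL x h hx0).ne' hx

theorem ne_zero_of_mem_isotropic (B : CoxeterForm M) {o x : EuclideanSpace ℝ ι}
    (hx : x ∈ B.isotropic o) : x ≠ 0 := by
  rintro rfl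
  simpa using hx.1

theorem normalized_mem_isotropic (B : CoxeterForm M) {o x : EuclideanSpace ℝ ι}
    (hL : B.PosDefOnHeightZero o) (hx : B.form x x = 0) (hx0 : x ≠ 0) :
    normalized o x ∈ B.isotropic o := by
  refine ⟨height_normalized o (B.height_ne_zero hL hx hx0), ?_⟩
  simp [normalized, hx]

theorem eq_of_form_nonneg_of_mem_isotropic (B : CoxeterForm M) {o x z : EuclideanSpace ℝ ι}
    (hL : B.PosDefOnHeightZero o) (hx : x ∈ B.isotropic o) (hz : z ∈ B.isotropic o)
    (hxz : 0 ≤ B.form x z) : z = x := by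
  by_contra hne
  have h := hL (x - z) (by rw [height_sub, hx.1, hz.1, sub_self]) (sub_ne_zero.2 (Ne.symm hne))
  simp only [map_sub, LinearMap.sub_apply, hx.2, hz.2, B.form_comm z x] at h
  linarith

/-! ### Limits of normalized roots -/

theorem height_pos_of_mem_roots (B : CoxeterForm M) (cs : CoxeterSystem M W)
    {o : EuclideanSpace ℝ ι} (ho : ∀ i, 0 < o i) {ρ : EuclideanSpace ℝ ι} (hρ : ρ ∈ B.roots cs)
    (hp : ∀ k, 0 ≤ ρ k) : 0 < height o ρ :=
  height_pos_of_nonneg ho hp (B.ne_zero_of_mem_roots cs hρ)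

theorem exists_nonneg_normalized_eq (B : CoxeterForm M) (cs : CoxeterSystem M W)
    (o : EuclideanSpace ℝ ι) {ρ : EuclideanSpace ℝ ι} (hρ : ρ ∈ B.roots cs) :
    ∃ ρ' ∈ B.roots cs, (∀ k, 0 ≤ ρ' k) ∧ normalized o ρ' = normalized o ρ := by
  rcases B.nonneg_or_nonpos_of_mem_roots cs hρ with h | h
  · exact ⟨ρ, hρ, h, rfl⟩
  · refine ⟨-ρ, B.neg_mem_roots cs hρ, fun k ↦ by simpa using h k, ?_⟩
    rw [← neg_one_smul ℝ, normalized_smul o (by norm_num)]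

theorem injOn_normalized_posRoots (B : CoxeterForm M) (cs : CoxeterSystem M W)
    {o : EuclideanSpace ℝ ι} (ho : ∀ i, 0 < o i) :
    Set.InjOn (normalized o) {ρ ∈ B.roots cs | ∀ k, 0 ≤ ρ k} := by
  rintro ρ ⟨hρ, hp⟩ ρ' ⟨hρ', hp'⟩ h
  have h0 := (B.height_pos_of_mem_roots cs ho hρ hp).ne'
  refine B.eq_of_eq_smul cs hρ hρ' hp hp' (c := height o ρ * (height o ρ')⁻¹) ?_
  rw [mul_smul, ← normalized, ← h, normalized, smul_smul, mul_inv_cancel₀ h0, one_smul]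

theorem tendsto_height_atTop (B : CoxeterForm M) (cs : CoxeterSystem M W)
    {o : EuclideanSpace ℝ ι} (ho : ∀ i, 0 < o i) {ρ : ℕ → EuclideanSpace ℝ ι}
    (hinj : Function.Injective ρ) (hρ : ∀ n, ρ n ∈ B.roots cs) (hp : ∀ n k, 0 ≤ ρ n k) :
    Tendsto (fun n ↦ height o (ρ n)) atTop atTop := by
  rw [tendsto_atTop]
  intro H
  rw [← Nat.cofinite_eq_atTop]
  have h := (B.finite_posRoots_height_le cs ho H).preimage hinj.injOn
  refine h.subset fun n hn ↦ ⟨hρ n, hp n, ?_⟩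
  simp only [Set.mem_compl_iff, Set.mem_ofPred_eq, not_le] at hn
  exact hn.le

/-- A limit root is the limit of the normalizations of distinct positive roots. -/
theorem exists_seq_of_mem_limitRoots (B : CoxeterForm M) (cs : CoxeterSystem M W)
    {o x : EuclideanSpace ℝ ι} (hx : x ∈ B.limitRoots cs o) :
    ∃ ρ : ℕ → EuclideanSpace ℝ ι, Function.Injective ρ ∧ (∀ n, ρ n ∈ B.roots cs) ∧
      (∀ n k, 0 ≤ ρ n k) ∧ Tendsto (fun n ↦ normalized o (ρ n)) atTop (𝓝 x) := by
  obtain ⟨u, hu, huA, hux⟩ := hx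
  choose σ hσ hσu using huA
  choose ρ hρ hp hρσ using fun n ↦ B.exists_nonneg_normalized_eq cs o (hσ n)
  have h : (fun n ↦ normalized o (ρ n)) = u := funext fun n ↦ by rw [hρσ, hσu]
  refine ⟨ρ, fun a b hab ↦ hu ?_, hρ, hp, by rwa [h]⟩
  rw [← h]
  simp only [hab]

theorem mem_isotropic_of_mem_limitRoots (B : CoxeterForm M) (cs : CoxeterSystem M W)
    {o : EuclideanSpace ℝ ι} (ho : ∀ i, 0 < o i) {x : EuclideanSpace ℝ ι}
    (hx : x ∈ B.limitRoots cs o) : x ∈ B.isotropic o := by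
  obtain ⟨ρ, hinj, hρ, hp, hlim⟩ := B.exists_seq_of_mem_limitRoots cs hx
  have hpos (n) := B.height_pos_of_mem_roots cs ho (hρ n) (hp n)
  have hat := B.tendsto_height_atTop cs ho hinj hρ hp
  constructor
  · have h1 := ((continuous_height o).tendsto x).comp hlim
    refine tendsto_nhds_unique h1 ?_
    simp only [Function.comp_def, fun n ↦ height_normalized o (hpos n).ne']
    exact tendsto_const_nhds
  · have h1 := ((B.continuous_form continuous_id continuous_id).tendsto x).comp hlim
    refine tendsto_nhds_unique h1 ?_
    have h2 : Tendsto (fun n ↦ (height o (ρ n))⁻¹ * (height o (ρ n))⁻¹) atTop (𝓝 (0 * 0)) :=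
      hat.inv_tendsto_atTop.mul hat.inv_tendsto_atTop
    rw [mul_zero] at h2
    refine h2.congr fun n ↦ ?_
    simp [normalized, B.form_self_of_mem_roots cs (hρ n)]

theorem normalizedAction_mem_isotropic (B : CoxeterForm M) (cs : CoxeterSystem M W)
    {o : EuclideanSpace ℝ ι} (hL : B.PosDefOnHeightZero o) {x : EuclideanSpace ℝ ι}
    (hx : x ∈ B.isotropic o) (w : W) : B.normalizedAction cs o w x ∈ B.isotropic o := by
  refine B.normalized_mem_isotropic hL ?_ ?_
  · rw [form_rep, hx.2]
  · simpa using B.ne_zero_of_mem_isotropic hx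

theorem normalizedAction_mul (B : CoxeterForm M) (cs : CoxeterSystem M W)
    {o : EuclideanSpace ℝ ι} (hL : B.PosDefOnHeightZero o) {x : EuclideanSpace ℝ ι}
    (hx : x ∈ B.isotropic o) (w w' : W) :
    B.normalizedAction cs o (w * w') x =
      B.normalizedAction cs o w (B.normalizedAction cs o w' x) := by
  have h0 : height o (B.rep cs w' x) ≠ 0 :=
    B.height_ne_zero hL (by rw [form_rep, hx.2]) (by simpa using B.ne_zero_of_mem_isotropic hx)
  rw [normalizedAction, normalizedAction, normalizedAction, normalized.eq_1 o (B.rep cs w' x),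
    map_smul, normalized_smul o (inv_ne_zero h0), map_mul, LinearEquiv.mul_apply]

theorem continuous_rep (B : CoxeterForm M) (cs : CoxeterSystem M W) (w : W) :
    Continuous (B.rep cs w) :=
  LinearMap.continuous_of_finiteDimensional (B.rep cs w).toLinearMap

theorem normalizedAction_mem_limitRoots (B : CoxeterForm M) (cs : CoxeterSystem M W)
    {o : EuclideanSpace ℝ ι} (ho : ∀ i, 0 < o i) (hL : B.PosDefOnHeightZero o)
    {x : EuclideanSpace ℝ ι} (hx : x ∈ B.limitRoots cs o) (w : W) :
    B.normalizedAction cs o w x ∈ B.limitRoots cs o := by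
  have hiso := B.mem_isotropic_of_mem_limitRoots cs ho hx
  obtain ⟨ρ, hinj, hρ, hp, hlim⟩ := B.exists_seq_of_mem_limitRoots cs hx
  have hpos (n) := B.height_pos_of_mem_roots cs ho (hρ n) (hp n)
  have h0 : height o (B.rep cs w x) ≠ 0 :=
    B.height_ne_zero hL (by rw [form_rep, hiso.2]) (by simpa using B.ne_zero_of_mem_isotropic hiso)
  refine ⟨fun n ↦ normalized o (B.rep cs w (ρ n)), fun a b hab ↦ ?_,
    fun n ↦ ⟨_, B.rep_mem_roots cs (hρ n) w, rfl⟩, ?_⟩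
  · have h1 (n) : height o (B.rep cs w (ρ n)) ≠ 0 := by
      rcases B.nonneg_or_nonpos_of_mem_roots cs (B.rep_mem_roots cs (hρ n) w) with h | h
      · exact (B.height_pos_of_mem_roots cs ho (B.rep_mem_roots cs (hρ n) w) h).ne'
      · have := B.height_pos_of_mem_roots cs ho
          (B.neg_mem_roots cs (B.rep_mem_roots cs (hρ n) w)) (fun k ↦ by simpa using h k)
        rw [height_neg] at this
        linarith
    refine hinj (B.eq_of_eq_smul cs (hρ a) (hρ b) (hp a) (hp b)
      (c := height o (B.rep cs w (ρ a)) * (height o (B.rep cs w (ρ b)))⁻¹) ?_)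
    apply (B.rep cs w).injective
    simp only [normalized] at hab
    rw [map_smul, mul_smul, ← hab, smul_smul, mul_inv_cancel₀ (h1 a), one_smul]
  · have h1 : Tendsto (fun n ↦ normalized o (B.rep cs w (normalized o (ρ n)))) atTop
        (𝓝 (normalized o (B.rep cs w x))) :=
      (continuousAt_normalized o h0).tendsto.comp (((B.continuous_rep cs w).tendsto x).comp hlim)
    refine h1.congr fun n ↦ ?_
    rw [normalized.eq_1 o (ρ n), map_smul, normalized_smul o (inv_ne_zero (hpos n).ne')]

/-- Every limit root lies in the closure of any nonempty subset of the projected isotropic cone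
that is stable under the normalized action: the reflections in a sequence of roots converging to
the limit root `x` move any point other than `x` towards `x`. -/
theorem mem_closure_of_mem_limitRoots (B : CoxeterForm M) (cs : CoxeterSystem M W)
    {o : EuclideanSpace ℝ ι} (ho : ∀ i, 0 < o i) (hL : B.PosDefOnHeightZero o)
    {F : Set (EuclideanSpace ℝ ι)} (hF : F ⊆ B.isotropic o) (hne : F.Nonempty)
    (hst : ∀ w, ∀ y ∈ F, B.normalizedAction cs o w y ∈ F) {x : EuclideanSpace ℝ ι}
    (hx : x ∈ B.limitRoots cs o) : x ∈ closure F := by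
  obtain ⟨y, hy⟩ := hne
  by_cases hyx : y = x
  · exact subset_closure (hyx ▸ hy)
  have hiso := B.mem_isotropic_of_mem_limitRoots cs ho hx
  have hxy : B.form x y ≠ 0 := fun h ↦
    hyx (B.eq_of_form_nonneg_of_mem_isotropic hL hiso (hF hy) h.ge)
  obtain ⟨ρ, hinj, hρ, hp, hlim⟩ := B.exists_seq_of_mem_limitRoots cs hx
  have hpos (n) := B.height_pos_of_mem_roots cs ho (hρ n) (hp n)
  have hat := B.tendsto_height_atTop cs ho hinj hρ hp
  choose t ht using fun n ↦ B.exists_rep_eq_reflection cs (hρ n)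
  refine mem_closure_of_tendsto (f := fun n ↦ B.normalizedAction cs o (t n) y) (b := atTop) ?_
    (Eventually.of_forall fun n ↦ hst (t n) y hy)
  have hc : Continuous fun p : ℝ × EuclideanSpace ℝ ι ↦
      (p.1 * p.1) • y - (2 * B.form p.2 y) • p.2 := by
    fun_prop
  have h1 : Tendsto (fun n ↦ ((height o (ρ n))⁻¹, normalized o (ρ n))) atTop (𝓝 (0, x)) :=
    hat.inv_tendsto_atTop.prodMk_nhds hlim
  have h2 := (hc.tendsto (0, x)).comp h1
  simp only [mul_zero, zero_smul, zero_sub, ← neg_smul] at h2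
  have h3 : -(2 * B.form x y) ≠ 0 := neg_ne_zero.2 (mul_ne_zero two_ne_zero hxy)
  have h4 : height o ((-(2 * B.form x y)) • x) ≠ 0 := by
    rwa [height_smul, hiso.1, mul_one]
  have h5 := (continuousAt_normalized o h4).tendsto.comp h2
  rw [normalized_smul o h3, normalized_eq_self o hiso.1] at h5
  refine h5.congr fun n ↦ ?_
  have h6 : B.rep cs (t n) y = (height o (ρ n) * height o (ρ n)) •
      (((height o (ρ n))⁻¹ * (height o (ρ n))⁻¹) • y -
        (2 * B.form (normalized o (ρ n)) y) • normalized o (ρ n)) := by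
    have := (hpos n).ne'
    rw [ht, normalized, smul_sub, smul_smul, smul_smul, smul_smul]
    congr 2
    · rw [← one_smul ℝ y, smul_smul]
      congr 1
      field_simp
    · simp only [map_smul, LinearMap.smul_apply, smul_eq_mul]
      field_simp
  have h7 := (mul_pos (hpos n) (hpos n)).ne'
  rw [normalizedAction, h6, normalized_smul o h7]
  rfl

end CoxeterForm

namespace CoxeterForm

variable {ι : Type*} [Fintype ι] [DecidableEq ι] {M : CoxeterMatrix ι}
variable {W : Type*} [Group W]

/-! ### Generating sets of simple roots -/

theorem isGenerating_iff (B : CoxeterForm M) {o : EuclideanSpace ℝ ι} (ho : ∀ i, 0 < o i)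
    (I : Set ι) : B.IsGenerating o I ↔ ∀ x ∈ B.isotropicSpan o I, ∀ k, 0 ≤ x k := by
  constructor
  · intro h x hx
    have hsub : normalized o '' simpleRoots (Set.univ : Set ι) ⊆ {v | ∀ k, 0 ≤ v k} := by
      rintro _ ⟨_, ⟨i, -, rfl⟩, rfl⟩ k
      rw [normalized, height_simpleRoot, PiLp.smul_apply, smul_eq_mul]
      exact mul_nonneg (inv_nonneg.2 (ho i).le) (simpleRoot_nonneg i k)
    refine convexHull_min hsub ?_ (h hx).1
    intro v hv v' hv' a b ha hb _ k
    simp only [PiLp.add_apply, PiLp.smul_apply, smul_eq_mul]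
    exact add_nonneg (mul_nonneg ha (hv k)) (mul_nonneg hb (hv' k))
  · intro h x hx
    refine ⟨?_, hx.2⟩
    have hsum : x = ∑ i, (o i * x i) • normalized o (simpleRoot i) := by
      conv_lhs => rw [eq_sum_smul_simpleRoot x]
      refine Finset.sum_congr rfl fun i _ ↦ ?_
      rw [normalized, height_simpleRoot, smul_smul, mul_right_comm, mul_inv_cancel₀ (ho i).ne',
        one_mul]
    rw [hsum]
    exact (convex_convexHull ℝ _).sum_mem (fun i _ ↦ mul_nonneg (ho i).le (h x hx i)) hx.1.1
      fun i _ ↦ subset_convexHull ℝ _ ⟨simpleRoot i, ⟨i, trivial, rfl⟩, rfl⟩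

/-- There is a generating set of simple roots with an isotropic vector in its span, namely any
minimal one on whose span the form is not positive definite. -/
theorem exists_isGenerating_nonempty (B : CoxeterForm M) {o : EuclideanSpace ℝ ι}
    (ho : ∀ i, 0 < o i) (hL : B.PosDefOnHeightZero o) (hev : B.IsNegativeUnitEigenvector o) :
    ∃ I, B.IsGenerating o I ∧ (B.isotropicSpan o I).Nonempty := by
  let S : Set (Set ι) := {I | ∃ v, v ≠ 0 ∧ (∀ k ∉ I, v k = 0) ∧ B.form v v ≤ 0}
  have hS : S.Nonempty := by
    obtain ⟨c, hc, hco⟩ := hev.exists_form_eq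
    refine ⟨Set.univ, o, ?_, fun k hk ↦ absurd trivial hk, ?_⟩
    · rintro rfl
      simpa using hev.height_self
    · rw [hco, hev.height_self, mul_one]
      exact hc.le
  obtain ⟨I, ⟨v, hv0, hvI, hvv⟩, hmin⟩ := (Set.toFinite S).exists_minimal hS
  have hpos (J : Set ι) (hJI : J ⊆ I) (hIJ : ¬ I ⊆ J) (u : EuclideanSpace ℝ ι) (hu : u ≠ 0)
      (huJ : ∀ k ∉ J, u k = 0) : 0 < B.form u u := by
    by_contra! h
    exact hIJ (hmin ⟨u, hu, huJ, h⟩ hJI)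
  refine ⟨I, ?_, ?_⟩
  · rw [isGenerating_iff B ho]
    rintro x ⟨⟨hx1, hxx⟩, hxI⟩
    rw [SetLike.mem_coe, mem_span_simpleRoots] at hxI
    by_contra! hneg
    obtain ⟨b, hb⟩ := hneg
    obtain ⟨a, ha⟩ : ∃ a, 0 < x a := by
      by_contra! h
      have : height o x ≤ 0 :=
        Finset.sum_nonpos fun k _ ↦ mul_nonpos_of_nonneg_of_nonpos (ho k).le (h k)
      linarith
    -- the positive and negative parts of `x` have supports strictly smaller than `I`
    obtain ⟨p, q, hxpq, hp, hq⟩ := exists_eq_sub_nonneg x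
    have hp0 (k) : 0 ≤ p k := (le_max_right _ _).trans_eq (hp k).symm
    have hq0 (k) : 0 ≤ q k := (le_max_right _ _).trans_eq (hq k).symm
    have hpq (k) : p k * q k = 0 := by
      rw [hp, hq]
      rcases le_total (x k) 0 with h | h <;> simp [h]
    have haI : a ∈ I := by
      by_contra h
      exact ha.ne' (hxI a h)
    have hbI : b ∈ I := by
      by_contra h
      exact hb.ne (hxI b h)
    have hBp : 0 < B.form p p := by
      refine hpos (I \ {b}) Set.sdiff_subset (fun h ↦ (h hbI).2 rfl) p ?_ fun k hk ↦ ?_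
      · rintro rfl
        have := hp a
        rw [max_eq_left ha.le] at this
        exact ha.ne this
      · rw [hp]
        by_cases hkb : k = b
        · rw [hkb, max_eq_right hb.le]
        · rw [hxI k fun h ↦ hk ⟨h, hkb⟩, max_self]
    have hBq : 0 < B.form q q := by
      refine hpos (I \ {a}) Set.sdiff_subset (fun h ↦ (h haI).2 rfl) q ?_ fun k hk ↦ ?_
      · rintro rfl
        have := hq b
        rw [max_eq_left (by linarith)] at this
        simp at this
        linarith
      · rw [hq]
        by_cases hka : k = a
        · rw [hka, max_eq_right (by linarith)]
        · rw [hxI k fun h ↦ hk ⟨h, hka⟩, neg_zero, max_self]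
    have hBpq := B.form_nonpos_of_disjoint hp0 hq0 hpq
    rw [hxpq] at hxx
    simp only [map_sub, LinearMap.sub_apply, B.form_comm q p] at hxx
    linarith
  · obtain ⟨j, hj⟩ : ∃ j, v j ≠ 0 := by
      by_contra! h
      exact hv0 (by ext k; simpa using h k)
    have hjI : j ∈ I := by
      by_contra h
      exact hj (hvI j h)
    -- the line through `v` in the direction of a simple root meets the isotropic cone
    set b := B.form v (simpleRoot j) with hb
    set s := -b + Real.sqrt (b ^ 2 - B.form v v) with hs
    have hsq : Real.sqrt (b ^ 2 - B.form v v) ^ 2 = b ^ 2 - B.form v v :=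
      Real.sq_sqrt (by nlinarith [sq_nonneg b])
    have hexp (r : ℝ) : B.form (v + r • simpleRoot j) (v + r • simpleRoot j) =
        B.form v v + 2 * r * b + r ^ 2 := by
      simp only [map_add, map_smul, LinearMap.add_apply, LinearMap.smul_apply, smul_eq_mul,
        form_simpleRoot, mat_self, B.form_comm (simpleRoot j) v, ← hb]
      ring
    have hiso : B.form (v + s • simpleRoot j) (v + s • simpleRoot j) = 0 := by
      rw [hexp]
      linear_combination hsq + (s + b + Real.sqrt (b ^ 2 - B.form v v)) * hs
    have hne : v + s • simpleRoot j ≠ 0 := by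
      intro h
      have hv : v = (-s) • simpleRoot j := by
        rw [neg_smul]
        exact eq_neg_of_add_eq_zero_left h
      have h1 : B.form v v = s ^ 2 := by
        rw [hv]
        simp only [map_smul, LinearMap.smul_apply, smul_eq_mul, form_simpleRoot, mat_self]
        ring
      have h2 : s = 0 := by
        have := sq_nonneg s
        exact pow_eq_zero_iff two_ne_zero |>.1 (by linarith)
      exact hv0 (by rw [hv, h2, neg_zero, zero_smul])
    refine ⟨normalized o (v + s • simpleRoot j), B.normalized_mem_isotropic hL hiso hne, ?_⟩
    refine Submodule.smul_mem _ _ (Submodule.add_mem _ (mem_span_simpleRoots.2 hvI)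
      (Submodule.smul_mem _ _ (Submodule.subset_span ⟨j, hjI, rfl⟩)))

/-! ### Root systems of parabolic subgroups -/

theorem parabolicRoots_subset (B : CoxeterForm M) (cs : CoxeterSystem M W) (I : Set ι) :
    B.parabolicRoots cs I ⊆ B.roots cs := by
  rintro _ ⟨w, -, i, -, rfl⟩
  exact ⟨w, i, rfl⟩

theorem simpleRoot_mem_parabolicRoots (B : CoxeterForm M) (cs : CoxeterSystem M W) {I : Set ι}
    {i : ι} (hi : i ∈ I) : simpleRoot i ∈ B.parabolicRoots cs I :=
  ⟨1, one_mem _, i, hi, by simp⟩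

theorem simpleReflection_mem_parabolicRoots (B : CoxeterForm M) (cs : CoxeterSystem M W)
    {I : Set ι} {i : ι} (hi : i ∈ I) {ρ : EuclideanSpace ℝ ι}
    (hρ : ρ ∈ B.parabolicRoots cs I) : B.simpleReflection i ρ ∈ B.parabolicRoots cs I := by
  obtain ⟨w, hw, j, hj, rfl⟩ := hρ
  refine ⟨cs.simple i * w, mul_mem (Subgroup.subset_closure ⟨i, hi, rfl⟩) hw, j, hj, ?_⟩
  rw [map_mul, LinearEquiv.mul_apply, rep_simple]

theorem rep_apply_of_notMem (B : CoxeterForm M) (cs : CoxeterSystem M W) {I : Set ι} {w : W}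
    (hw : w ∈ Subgroup.closure (cs.simple '' I)) {k : ι} (hk : k ∉ I) (v : EuclideanSpace ℝ ι) :
    B.rep cs w v k = v k := by
  induction hw using Subgroup.closure_induction generalizing v with
  | mem x hx =>
    obtain ⟨i, hi, rfl⟩ := hx
    rw [rep_simple, simpleReflection_apply, PiLp.sub_apply, PiLp.smul_apply,
      simpleRoot_of_ne (by rintro rfl; exact hk hi), smul_zero, sub_zero]
  | one => simp
  | mul x y _ _ hx hy => rw [map_mul, LinearEquiv.mul_apply, hx, hy]
  | inv x _ hx => rw [← hx, rep_rep_inv]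

theorem apply_eq_zero_of_mem_parabolicRoots (B : CoxeterForm M) (cs : CoxeterSystem M W)
    {I : Set ι} {ρ : EuclideanSpace ℝ ι} (hρ : ρ ∈ B.parabolicRoots cs I) {k : ι} (hk : k ∉ I) :
    ρ k = 0 := by
  obtain ⟨w, hw, i, hi, rfl⟩ := hρ
  rw [rep_apply_of_notMem B cs hw hk, simpleRoot_of_ne]
  rintro rfl
  exact hk hi

theorem parabolicLimitRoots_subset (B : CoxeterForm M) (cs : CoxeterSystem M W)
    (o : EuclideanSpace ℝ ι) (I : Set ι) :
    B.parabolicLimitRoots cs o I ⊆ B.limitRoots cs o :=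
  accumulationPoints_mono (Set.image_mono (B.parabolicRoots_subset cs I))

theorem parabolicLimitRoots_subset_isotropicSpan (B : CoxeterForm M) (cs : CoxeterSystem M W)
    {o : EuclideanSpace ℝ ι} (ho : ∀ i, 0 < o i) (I : Set ι) :
    B.parabolicLimitRoots cs o I ⊆ B.isotropicSpan o I := by
  intro x hx
  refine ⟨B.mem_isotropic_of_mem_limitRoots cs ho (B.parabolicLimitRoots_subset cs o I hx), ?_⟩
  obtain ⟨u, -, huA, hux⟩ := hx
  refine (Submodule.closed_of_finiteDimensional _).mem_of_tendsto hux
    (Eventually.of_forall fun n ↦ ?_)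
  obtain ⟨ρ, hρ, h⟩ := huA n
  rw [← h]
  exact Submodule.smul_mem _ _ (mem_span_simpleRoots.2 fun k hk ↦
    B.apply_eq_zero_of_mem_parabolicRoots cs hρ hk)

/-! ### Isotropic vectors in the span of a generating set -/

/-- The positive roots of `W_I` whose product with `x` is nonnegative. -/
def nonnegRoots (B : CoxeterForm M) (cs : CoxeterSystem M W) (I : Set ι)
    (x : EuclideanSpace ℝ ι) : Set (EuclideanSpace ℝ ι) :=
  {ρ ∈ B.parabolicRoots cs I | (∀ k, 0 ≤ ρ k) ∧ 0 ≤ B.form x ρ}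

/-- Limits `z` of normalized roots in `nonnegRoots x` satisfy `B(x, z) ≥ 0`, which in the
isotropic cone holds for `z = x` only. -/
theorem mem_parabolicLimitRoots_of_infinite (B : CoxeterForm M) (cs : CoxeterSystem M W)
    {o : EuclideanSpace ℝ ι} (ho : ∀ i, 0 < o i) (hL : B.PosDefOnHeightZero o) {I : Set ι}
    {x : EuclideanSpace ℝ ι} (hx : x ∈ B.isotropic o)
    (hinf : (B.nonnegRoots cs I x).Infinite) : x ∈ B.parabolicLimitRoots cs o I := by
  have hpos : ∀ ρ ∈ B.nonnegRoots cs I x, 0 < height o ρ := fun ρ hρ ↦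
    B.height_pos_of_mem_roots cs ho (B.parabolicRoots_subset cs I hρ.1) hρ.2.1
  have hinf' : (normalized o '' B.nonnegRoots cs I x).Infinite := by
    refine hinf.image ((B.injOn_normalized_posRoots cs ho).mono ?_)
    exact fun ρ hρ ↦ ⟨B.parabolicRoots_subset cs I hρ.1, hρ.2.1⟩
  obtain ⟨K, hK, hsub⟩ := exists_isCompact_of_height_le ho 1
  have hsubK : normalized o '' B.nonnegRoots cs I x ⊆ K := by
    rintro _ ⟨ρ, hρ, rfl⟩
    refine hsub ⟨fun k ↦ ?_, (height_normalized o (hpos ρ hρ).ne').le⟩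
    exact mul_nonneg (inv_nonneg.2 (hpos ρ hρ).le) (hρ.2.1 k)
  obtain ⟨z, hz⟩ := hinf'.exists_mem_accumulationPoints hK hsubK
  have hzI : z ∈ B.parabolicLimitRoots cs o I := by
    refine accumulationPoints_mono (Set.image_mono ?_) hz
    exact fun ρ hρ ↦ hρ.1
  have hziso := (B.parabolicLimitRoots_subset_isotropicSpan cs ho I hzI).1
  have hxz : 0 ≤ B.form x z := by
    obtain ⟨u, -, huA, huz⟩ := hz
    refine ge_of_tendsto
      (((B.continuous_form continuous_const continuous_id).tendsto z).comp huz)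
      (Eventually.of_forall fun n ↦ ?_)
    obtain ⟨ρ, hρ, h⟩ := huA n
    simp only [Function.comp_apply, id, ← h, normalized, map_smul, smul_eq_mul]
    exact mul_nonneg (inv_nonneg.2 (hpos ρ hρ).le) hρ.2.2
  rwa [← B.eq_of_form_nonneg_of_mem_isotropic hL hx hziso hxz]

/-- If the isotropic vector `x` lies in the closed cone opposite to the fundamental chamber of
`W_I`, then `x` lies in the radical of the form on the span of its support `J`, and `W_J` has
infinitely many roots: a positive root of maximal height would be orthogonal to all of `Δ_J`. -/
theorem infinite_nonnegRoots_of_form_nonpos (B : CoxeterForm M) (cs : CoxeterSystem M W)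
    {o : EuclideanSpace ℝ ι} (ho : ∀ i, 0 < o i) {I : Set ι} {x : EuclideanSpace ℝ ι}
    (hx0 : x ≠ 0) (hxx : B.form x x = 0) (hxI : ∀ k ∉ I, x k = 0) (hxp : ∀ k, 0 ≤ x k)
    (hneg : ∀ i ∈ I, B.form x (simpleRoot i) ≤ 0) : (B.nonnegRoots cs I x).Infinite := by
  intro hfin
  have hI {k} (hk : x k ≠ 0) : k ∈ I := by
    by_contra h
    exact hk (hxI k h)
  have horth : ∀ k, x k ≠ 0 → B.form (simpleRoot k) x = 0 := by
    intro k hk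
    rw [form_eq_sum] at hxx
    refine (mul_eq_zero.1 ((Finset.sum_eq_zero_iff_of_nonpos fun i _ ↦ ?_).1 hxx k
      (Finset.mem_univ k))).resolve_left hk
    by_cases hi : x i = 0
    · rw [hi, zero_mul]
    · exact mul_nonpos_of_nonneg_of_nonpos (hxp i) (by rw [form_comm]; exact hneg i (hI hi))
  let T := {ρ ∈ B.nonnegRoots cs I x | ∀ k, x k = 0 → ρ k = 0}
  have hTfin : T.Finite := hfin.subset fun ρ hρ ↦ hρ.1
  obtain ⟨j, hj⟩ : ∃ j, x j ≠ 0 := by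
    by_contra! h
    exact hx0 (by ext k; simpa using h k)
  have hjT : simpleRoot j ∈ T := by
    refine ⟨⟨B.simpleRoot_mem_parabolicRoots cs (hI hj), simpleRoot_nonneg j, ?_⟩, fun k hk ↦ ?_⟩
    · rw [form_comm, horth j hj]
    · exact simpleRoot_of_ne (by rintro rfl; exact hj hk)
  obtain ⟨β, hβ, hmax⟩ := Set.exists_max_image T (height o) hTfin ⟨_, hjT⟩
  have hge : ∀ k, x k ≠ 0 → 0 ≤ B.form (simpleRoot k) β := by
    intro k hk
    by_contra! hlt
    have hT : B.simpleReflection k β ∈ T := by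
      refine ⟨⟨B.simpleReflection_mem_parabolicRoots cs (hI hk) hβ.1.1, fun l ↦ ?_, ?_⟩,
        fun l hl ↦ ?_⟩
      · rw [simpleReflection_apply, PiLp.sub_apply, PiLp.smul_apply, smul_eq_mul]
        have h1 := hβ.1.2.1 l
        by_cases hlk : l = k
        · rw [hlk] at h1 ⊢
          rw [simpleRoot_self]
          linarith
        · rw [simpleRoot_of_ne hlk]
          linarith
      · rw [simpleReflection_apply, map_sub, map_smul, B.form_comm x (simpleRoot k), horth k hk,
          smul_zero, sub_zero]
        exact hβ.1.2.2
      · rw [simpleReflection_apply, PiLp.sub_apply, PiLp.smul_apply, hβ.2 l hl,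
          simpleRoot_of_ne (by rintro rfl; exact hk hl), smul_zero, sub_zero]
    have h1 := hmax _ hT
    rw [simpleReflection_apply, height_sub, height_smul, height_simpleRoot] at h1
    nlinarith [ho k]
  have hβx : B.form x β = 0 := by
    rw [form_comm, form_eq_sum]
    refine Finset.sum_eq_zero fun k _ ↦ ?_
    by_cases hk : x k = 0
    · rw [hβ.2 k hk, zero_mul]
    · rw [horth k hk, mul_zero]
  have hzero : ∀ k, x k ≠ 0 → B.form (simpleRoot k) β = 0 := by
    intro k hk
    rw [form_eq_sum] at hβx
    refine (mul_eq_zero.1 ((Finset.sum_eq_zero_iff_of_nonneg fun i _ ↦ ?_).1 hβx k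
      (Finset.mem_univ k))).resolve_left hk
    by_cases hi : x i = 0
    · rw [hi, zero_mul]
    · exact mul_nonneg (hxp i) (hge i hi)
  have hββ := B.form_self_of_mem_roots cs (B.parabolicRoots_subset cs I hβ.1.1)
  rw [form_eq_sum, Finset.sum_eq_zero fun k _ ↦ ?_] at hββ
  · exact zero_ne_one hββ
  · by_cases hk : x k = 0
    · rw [hβ.2 k hk, zero_mul]
    · rw [hzero k hk, mul_zero]

/-- The set of positive roots with nonnegative product with `x` shrinks when `x` is replaced by
`s i x`, if `B(x, α i) > 0`. -/
theorem ncard_nonnegRoots_simpleReflection_lt (B : CoxeterForm M) (cs : CoxeterSystem M W)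
    {I : Set ι} {x : EuclideanSpace ℝ ι} {i : ι} (hi : i ∈ I)
    (hpos : 0 < B.form x (simpleRoot i)) (hfin : (B.nonnegRoots cs I x).Finite) :
    (B.nonnegRoots cs I (B.simpleReflection i x)).Finite ∧
      (B.nonnegRoots cs I (B.simpleReflection i x)).ncard < (B.nonnegRoots cs I x).ncard := by
  have hinv (v) : B.simpleReflection i (B.simpleReflection i v) = v :=
    Module.involutive_reflection (B.two_form_simpleRoot i) v
  have hmem : simpleRoot i ∈ B.nonnegRoots cs I x :=
    ⟨B.simpleRoot_mem_parabolicRoots cs hi, (simpleRoot_nonneg i), hpos.le⟩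
  have hsub : B.nonnegRoots cs I (B.simpleReflection i x) ⊆
      B.simpleReflection i '' (B.nonnegRoots cs I x \ {simpleRoot i}) := by
    rintro ρ ⟨hρ, hp, hρx⟩
    have hroot := B.parabolicRoots_subset cs I hρ
    have hform : B.form (B.simpleReflection i x) ρ = B.form x (B.simpleReflection i ρ) := by
      rw [← B.form_simpleReflection i, hinv]
    have hne : ρ ≠ simpleRoot i := by
      rintro rfl
      rw [hform, simpleReflection_simpleRoot, map_neg] at hρx
      linarith
    obtain ⟨k, hki, hk⟩ : ∃ k, k ≠ i ∧ ρ k ≠ 0 := by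
      by_contra! h
      refine hne (B.eq_of_eq_smul cs hroot (B.simpleRoot_mem_roots cs i) hp (simpleRoot_nonneg i)
        (c := ρ i) ?_)
      ext k
      by_cases hk : k = i
      · rw [hk, PiLp.smul_apply, simpleRoot_self, smul_eq_mul, mul_one]
      · rw [h k hk, PiLp.smul_apply, simpleRoot_of_ne hk, smul_zero]
    have hk' : 0 < B.simpleReflection i ρ k := by
      rw [simpleReflection_apply, PiLp.sub_apply, PiLp.smul_apply, simpleRoot_of_ne hki, smul_zero,
        sub_zero]
      exact lt_of_le_of_ne (hp k) hk.symm
    have hρ' := B.simpleReflection_mem_parabolicRoots cs hi hρ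
    refine ⟨B.simpleReflection i ρ, ⟨⟨hρ', B.nonneg_of_mem_roots cs
      (B.parabolicRoots_subset cs I hρ') hk', hform ▸ hρx⟩, ?_⟩, hinv ρ⟩
    intro h
    rw [Set.mem_singleton_iff] at h
    rw [← hinv ρ, h, simpleReflection_simpleRoot] at hp
    have := hp i
    rw [PiLp.neg_apply, simpleRoot_self] at this
    linarith
  have hfin' : (B.nonnegRoots cs I x \ {simpleRoot i}).Finite := hfin.subset Set.sdiff_subset
  refine ⟨(hfin'.image _).subset hsub, ?_⟩
  calc _ ≤ _ := Set.ncard_le_ncard hsub (hfin'.image _)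
    _ ≤ _ := Set.ncard_image_le hfin'
    _ < _ := Set.ncard_sdiff_singleton_lt_of_mem hmem hfin

/-- A finite `nonnegRoots x` could be made smaller and smaller by moving `x` towards the cone
opposite to the fundamental chamber of `W_I`, where it is infinite. -/
theorem infinite_nonnegRoots (B : CoxeterForm M) (cs : CoxeterSystem M W)
    {o : EuclideanSpace ℝ ι} (ho : ∀ i, 0 < o i) (hL : B.PosDefOnHeightZero o) {I : Set ι}
    (hI : B.IsGenerating o I) {x : EuclideanSpace ℝ ι} (hxx : B.form x x = 0)
    (hx : 0 < height o x) (hxI : ∀ k ∉ I, x k = 0) : (B.nonnegRoots cs I x).Infinite := by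
  rw [isGenerating_iff B ho] at hI
  have hnn (y : EuclideanSpace ℝ ι) (hyy : B.form y y = 0) (hy : 0 < height o y)
      (hyI : ∀ k ∉ I, y k = 0) (k : ι) : 0 ≤ y k := by
    have h := hI (normalized o y) ⟨⟨height_normalized o hy.ne', by simp [normalized, hyy]⟩,
      Submodule.smul_mem _ _ (mem_span_simpleRoots.2 hyI)⟩ k
    exact nonneg_of_mul_nonneg_right h (inv_pos.2 hy)
  intro hfin
  induction hn : (B.nonnegRoots cs I x).ncard using Nat.strong_induction_on generalizing x with
  | _ n ih =>
  have hxp := hnn x hxx hx hxI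
  have hx0 : x ≠ 0 := by
    rintro rfl
    simp at hx
  by_cases hex : ∃ i ∈ I, 0 < B.form x (simpleRoot i)
  · obtain ⟨i, hi, hpos⟩ := hex
    obtain ⟨hfin', hlt⟩ := B.ncard_nonnegRoots_simpleReflection_lt cs hi hpos hfin
    have hyk {k : ι} (hk : k ≠ i) : B.simpleReflection i x k = x k := by
      rw [simpleReflection_apply, PiLp.sub_apply, PiLp.smul_apply, simpleRoot_of_ne hk, smul_zero,
        sub_zero]
    have hyy : B.form (B.simpleReflection i x) (B.simpleReflection i x) = 0 := by
      rw [form_simpleReflection, hxx]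
    have hyI : ∀ k ∉ I, B.simpleReflection i x k = 0 := by
      intro k hk
      rw [hyk (by rintro rfl; exact hk hi), hxI k hk]
    have hy0 : B.simpleReflection i x ≠ 0 := by simpa using hx0
    refine ih _ (hn ▸ hlt) hyy ?_ hyI hfin' rfl
    -- otherwise `x` and `-s i x` would both be nonnegative, so `x` would be a multiple of `α i`
    by_contra! hle
    have hlt := lt_of_le_of_ne hle (B.height_ne_zero hL hyy hy0)
    have hnp := hnn (-B.simpleReflection i x) (by simp [hyy]) (by rw [height_neg]; linarith)
      (fun k hk ↦ by simp [hyI k hk])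
    have hxk : x = x i • simpleRoot i := by
      ext k
      by_cases hk : k = i
      · rw [hk, PiLp.smul_apply, simpleRoot_self, smul_eq_mul, mul_one]
      · have h1 := hnp k
        rw [PiLp.neg_apply, hyk hk] at h1
        rw [PiLp.smul_apply, simpleRoot_of_ne hk, smul_zero]
        exact le_antisymm (by linarith) (hxp k)
    have h2 := hxx
    rw [hxk] at h2
    simp only [map_smul, LinearMap.smul_apply, form_simpleRoot, mat_self, smul_eq_mul, mul_one,
      mul_self_eq_zero] at h2
    exact hx0 (by rw [hxk, h2, zero_smul])
  · push Not at hex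
    exact B.infinite_nonnegRoots_of_form_nonpos cs ho hx0 hxx hxI hxp hex hfin

theorem parabolicLimitRoots_eq (B : CoxeterForm M) (cs : CoxeterSystem M W)
    {o : EuclideanSpace ℝ ι} (ho : ∀ i, 0 < o i) (hL : B.PosDefOnHeightZero o) {I : Set ι}
    (hI : B.IsGenerating o I) : B.parabolicLimitRoots cs o I = B.isotropicSpan o I := by
  refine (B.parabolicLimitRoots_subset_isotropicSpan cs ho I).antisymm fun x hx ↦ ?_
  exact B.mem_parabolicLimitRoots_of_infinite cs ho hL hx.1
    (B.infinite_nonnegRoots cs ho hL hI hx.1.2 (by rw [hx.1.1]; exact one_pos)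
      (mem_span_simpleRoots.1 hx.2))

/-! ### The self-similar set -/

theorem selfSimilarSet_subset_isotropic (B : CoxeterForm M) (cs : CoxeterSystem M W)
    {o : EuclideanSpace ℝ ι} (hL : B.PosDefOnHeightZero o) :
    B.selfSimilarSet cs o ⊆ B.isotropic o := by
  rintro _ ⟨w, I, -, x, hx, rfl⟩
  exact B.normalizedAction_mem_isotropic cs hL hx.1 w

theorem normalizedAction_mem_selfSimilarSet (B : CoxeterForm M) (cs : CoxeterSystem M W)
    {o : EuclideanSpace ℝ ι} (hL : B.PosDefOnHeightZero o) (w : W) {y : EuclideanSpace ℝ ι}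
    (hy : y ∈ B.selfSimilarSet cs o) : B.normalizedAction cs o w y ∈ B.selfSimilarSet cs o := by
  obtain ⟨w', I, hI, x, hx, rfl⟩ := hy
  exact ⟨w * w', I, hI, x, hx, (B.normalizedAction_mul cs hL hx.1 w w').symm⟩

theorem image_normalizedAction_selfSimilarSet (B : CoxeterForm M) (cs : CoxeterSystem M W)
    {o : EuclideanSpace ℝ ι} (hL : B.PosDefOnHeightZero o) (w : W) :
    B.normalizedAction cs o w '' B.selfSimilarSet cs o = B.selfSimilarSet cs o := by
  apply Set.Subset.antisymm
  · rintro _ ⟨y, hy, rfl⟩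
    exact B.normalizedAction_mem_selfSimilarSet cs hL w hy
  · intro y hy
    refine ⟨_, B.normalizedAction_mem_selfSimilarSet cs hL w⁻¹ hy, ?_⟩
    have hiso := B.selfSimilarSet_subset_isotropic cs hL hy
    rw [← B.normalizedAction_mul cs hL hiso, mul_inv_cancel, normalizedAction, map_one,
      LinearEquiv.coe_one, id, normalized_eq_self o hiso.1]

theorem limitRoots_eq_closure (B : CoxeterForm M) (cs : CoxeterSystem M W)
    {o : EuclideanSpace ℝ ι} (ho : ∀ i, 0 < o i) (hL : B.PosDefOnHeightZero o)
    (hev : B.IsNegativeUnitEigenvector o) :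
    B.limitRoots cs o = closure (B.selfSimilarSet cs o) := by
  apply Set.Subset.antisymm
  · obtain ⟨I, hI, x, hx⟩ := B.exists_isGenerating_nonempty ho hL hev
    exact fun y hy ↦ B.mem_closure_of_mem_limitRoots cs ho hL
      (B.selfSimilarSet_subset_isotropic cs hL) ⟨_, 1, I, hI, x, hx, rfl⟩
      (fun w z hz ↦ B.normalizedAction_mem_selfSimilarSet cs hL w hz) hy
  · refine closure_minimal ?_ (isClosed_accumulationPoints _)
    rintro _ ⟨w, I, hI, x, hx, rfl⟩
    refine B.normalizedAction_mem_limitRoots cs ho hL ?_ w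
    rw [← B.parabolicLimitRoots_eq cs ho hL hI] at hx
    exact B.parabolicLimitRoots_subset cs o I hx

/-! ### Changing the sign of the eigenvector -/

open scoped Pointwise

theorem normalized_neg_left {ι : Type*} [Fintype ι] (o v : EuclideanSpace ℝ ι) :
    normalized (-o) v = -normalized o v := by
  have h : height (-o) v = -height o v := by simp [height]
  rw [normalized, normalized, h, inv_neg, neg_smul]

theorem normalized_neg_right {ι : Type*} [Fintype ι] (o v : EuclideanSpace ℝ ι) :
    normalized o (-v) = normalized o v := by
  rw [← neg_one_smul ℝ, normalized_smul o (by norm_num)]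

theorem image_normalized_neg {ι : Type*} [Fintype ι] (o : EuclideanSpace ℝ ι)
    (A : Set (EuclideanSpace ℝ ι)) : normalized (-o) '' A = -(normalized o '' A) := by
  rw [← Set.image_neg_eq_neg, Set.image_image]
  exact Set.image_congr fun v _ ↦ normalized_neg_left o v

theorem accumulationPoints_neg {X : Type*} [TopologicalSpace X] [InvolutiveNeg X]
    [ContinuousNeg X] (A : Set X) : accumulationPoints (-A) = -accumulationPoints A := by
  have h (A : Set X) : accumulationPoints (-A) ⊆ -accumulationPoints A := fun x ⟨u, hu, hA, hx⟩ ↦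
    ⟨fun k ↦ -u k, neg_injective.comp hu, hA, hx.neg⟩
  refine (h A).antisymm fun x hx ↦ ?_
  have h' := h (-A)
  rw [neg_neg] at h'
  simpa using h' hx

section Neg

variable (B : CoxeterForm M) (cs : CoxeterSystem M W) (o : EuclideanSpace ℝ ι)

theorem isotropic_neg : B.isotropic (-o) = -B.isotropic o := by
  ext x
  simp [isotropic, height]

theorem isotropicSpan_neg (I : Set ι) : B.isotropicSpan (-o) I = -B.isotropicSpan o I := by
  ext x
  simp [isotropicSpan, isotropic_neg]

theorem isGenerating_neg_iff (I : Set ι) : B.IsGenerating (-o) I ↔ B.IsGenerating o I := by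
  have h : convexHull ℝ (normalized (-o) '' simpleRoots (Set.univ : Set ι)) ∩
      (Submodule.span ℝ (simpleRoots I) : Set (EuclideanSpace ℝ ι)) =
      -(convexHull ℝ (normalized o '' simpleRoots (Set.univ : Set ι)) ∩
        (Submodule.span ℝ (simpleRoots I) : Set (EuclideanSpace ℝ ι))) := by
    rw [image_normalized_neg, convexHull_neg, Set.inter_neg]
    congr 1
    ext x
    simp
  rw [IsGenerating, IsGenerating, h, isotropicSpan_neg, Set.neg_subset_neg]

theorem normalizedAction_neg (w : W) (v : EuclideanSpace ℝ ι) :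
    B.normalizedAction cs (-o) w (-v) = -B.normalizedAction cs o w v := by
  rw [normalizedAction, normalizedAction, map_neg, normalized_neg_left, normalized_neg_right]

theorem selfSimilarSet_neg : B.selfSimilarSet cs (-o) = -B.selfSimilarSet cs o := by
  have h (o : EuclideanSpace ℝ ι) : B.selfSimilarSet cs (-o) ⊆ -B.selfSimilarSet cs o := by
    rintro _ ⟨w, I, hI, x, hx, rfl⟩
    rw [isotropicSpan_neg] at hx
    refine ⟨w, I, (B.isGenerating_neg_iff o I).1 hI, -x, hx, ?_⟩
    rw [← neg_neg x, normalizedAction_neg, neg_neg, neg_neg]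
  refine (h o).antisymm fun x hx ↦ ?_
  have h' := h (-o)
  rw [neg_neg] at h'
  simpa using h' hx

theorem limitRoots_neg : B.limitRoots cs (-o) = -B.limitRoots cs o := by
  rw [limitRoots, image_normalized_neg, accumulationPoints_neg, ← limitRoots]

theorem parabolicLimitRoots_neg (I : Set ι) :
    B.parabolicLimitRoots cs (-o) I = -B.parabolicLimitRoots cs o I := by
  rw [parabolicLimitRoots, image_normalized_neg, accumulationPoints_neg, ← parabolicLimitRoots]

end Neg

end CoxeterForm

theorem mainTheorem5 {ι : Type*} [Fintype ι] [DecidableEq ι] {M : CoxeterMatrix ι}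
    {W : Type*} [Group W] (cs : CoxeterSystem M W) (B : CoxeterForm M)
    (hirr : B.IsIrreducible) (hsig : B.HasSignature (Fintype.card ι - 1) 1)
    (o : EuclideanSpace ℝ ι) (ho : B.IsNegativeUnitEigenvector o) :
    (∀ I : Set ι, B.IsGenerating o I →
      B.parabolicLimitRoots cs o I = B.isotropicSpan o I) ∧
    B.selfSimilarSet cs o ⊆ B.isotropic o ∧
    (∀ w : W, B.normalizedAction cs o w '' B.selfSimilarSet cs o = B.selfSimilarSet cs o) ∧
    B.limitRoots cs o = closure (B.selfSimilarSet cs o) := by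
  have hL := ho.posDefOnHeightZero hsig
  rcases ho.pos_or_neg hirr hsig with hpos | hpos
  · exact ⟨fun I hI ↦ B.parabolicLimitRoots_eq cs hpos hL hI,
      B.selfSimilarSet_subset_isotropic cs hL,
      B.image_normalizedAction_selfSimilarSet cs hL, B.limitRoots_eq_closure cs hpos hL ho⟩
  · refine ⟨fun I hI ↦ ?_, B.selfSimilarSet_subset_isotropic cs hL,
      B.image_normalizedAction_selfSimilarSet cs hL, ?_⟩
    · have h := B.parabolicLimitRoots_eq cs hpos (ho.neg.posDefOnHeightZero hsig)
        ((B.isGenerating_neg_iff o I).2 hI)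
      rwa [B.parabolicLimitRoots_neg, B.isotropicSpan_neg, neg_inj] at h
    · have h := B.limitRoots_eq_closure cs hpos (ho.neg.posDefOnHeightZero hsig) ho.neg
      rwa [B.limitRoots_neg, B.selfSimilarSet_neg, ← neg_closure, neg_inj] at h
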